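/- Let $n\ge 2$, $\rho=\frac{n-1}{2}$. Let $G=\mathrm{Spin}_0(1,n)$ be the group of products, in the Clifford algebra of $\mathbb R^{1,n}$ with $xy+yx=2(x_0y_0-x_1y_1-\dots-x_ny_n)$, of an even number of vectors $x$ with $x^2=\pm1$, an even number of them with $x^2=-1$. Let $e_0,\dots,e_n$ be the standard basis, let $K=\mathrm{Spin}(n)\subset G$ be the group of even products of unit vectors of $\mathbb R^n=\mathrm{span}(e_1,\dots,e_n)$ and $M=\mathrm{Spin}(n-1)\subset K$ that of $\mathrm{span}(e_1,\dots,e_{n-1})$. Put $a_t=\cosh\frac t2+\sinh\frac t2\,e_0e_n$ (the one-parameter group over the hyperbolic boosts of length $t$), and let $N$ be the analytic subgroup with Lie algebra $\bigoplus_{j=1}^{n-1}\mathbb R\,e_j(e_0-e_n)$, so that $\mathrm{Ad}(a_t)=e^{t}$ on it and $\rho$ is the half-sum of the positive roots. Write the Iwasawa decomposition $G=KAN$ as $g=\kappa(g)\,a_{H(g)}\,n(g)$ with $\kappa(g)\in K$, $H(g)\in\mathbb R$, $n(g)\in N$. Let $dk$ be the normalized Haar measure of $K$. Let $\tau$ be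 one of the half-spin representations $\tau_n^{\pm}$ of $K$ if $n$ is even, and the spin representation $\tau_n$ if $n$ is odd, realized unitarily on (the even or odd part of, resp. all of) $\bigwedge\mathbb C^{\lfloor n/2\rfloor}$. Let $\sigma\in\widehat M(\tau)$, i.e. $\sigma$ is an irreducible unitary representation of $M$ on $V_\sigma$ that occurs in $\tau|_M$, with isometric $M$-equivariant embedding $\iota_\sigma^\tau:V_\sigma\to V_\tau$. For $1<p<\infty$ let $L^p(K/M,\sigma)$ be the space of $f:K\to V_\sigma$ with $f(km)=\sigma(m^{-1})f(k)$ and $\|f\|_{L^p(K/M,\sigma)}=\left(\int_K\|f(k)\|^p\,dk\right)^{1/p}<\infty$. For $\lambda\in\mathbb C$ the Poisson transform is $$\mathcal P_{\sigma,\lambda}^\tau f(g)=\varkappa\int_K e^{-(i\lambda+\rho)H(g^{-1}k)}\,\tau(\kappa(g^{-1}k))\,\iota_\sigma^\tau(f(k))\,dk,\qquad \varkappa=\sqrt{\frac{\dim\tau}{\dim\sigma}}.$$ **Proposition.** Let $\lambda\in\mathbb C$ with $\operatorname{Re}(i\lambda)>0$. There is a constant $\gamma_\lambda>0$, depending only on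 $n$ and $\lambda$, such that for all $\tau$ and $\sigma$ as above, all $1<p<\infty$ and all $f\in L^p(K/M,\sigma)$, the integral defining $\mathcal P_{\sigma,\lambda}^\tau f(g)$ converges absolutely for every $g\in G$, and for every $t\ge 0$ the function $k\mapsto\mathcal P_{\sigma,\lambda}^\tau f(ka_t)$ is in $L^p(K;V_\tau)$ with $$\left(\int_K\bigl\|\mathcal P_{\sigma,\lambda}^\tau f(ka_t)\bigr\|_\tau^p\,dk\right)^{1/p}\le \varkappa\,\gamma_\lambda\,e^{(\operatorname{Re}(i\lambda)-\rho)t}\,\|f\|_{L^p(K/M,\sigma)}.$$ -/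

import Mathlib

open MeasureTheory CliffordAlgebra
open scoped ENNReal

noncomputable section

namespace SpinPoisson

/-! ### Functoriality of Spin groups -/

section SpinMap

variable {V W : Type*} [AddCommGroup V] [Module ℝ V] [AddCommGroup W] [Module ℝ W]
  {Q₁ : QuadraticForm ℝ V} {Q₂ : QuadraticForm ℝ W}

theorem map_involute (f : Q₁ →qᵢ Q₂) (x : CliffordAlgebra Q₁) :
    CliffordAlgebra.map f (involute x) = involute (CliffordAlgebra.map f x) := by
  have h : (CliffordAlgebra.map f).comp involute = involute.comp (CliffordAlgebra.map f) := by
    ext v; simp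
  exact DFunLike.congr_fun h x

theorem map_reverse (f : Q₁ →qᵢ Q₂) (x : CliffordAlgebra Q₁) :
    CliffordAlgebra.map f (reverse x) = reverse (CliffordAlgebra.map f x) := by
  induction x using CliffordAlgebra.induction with
  | algebraMap r => simp
  | ι v => simp
  | mul a b ha hb => simp [reverse.map_mul, ha, hb]
  | add a b ha hb => simp [ha, hb]

theorem map_mem_spinGroup (f : Q₁ →qᵢ Q₂) {x : CliffordAlgebra Q₁} (hx : x ∈ spinGroup Q₁) :
    CliffordAlgebra.map f x ∈ spinGroup Q₂ := by
  have hU : star x * x = 1 ∧ x * star x = 1 :=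
    ⟨spinGroup.star_mul_self_of_mem hx, spinGroup.mul_star_self_of_mem hx⟩
  have hs : star (CliffordAlgebra.map f x) = CliffordAlgebra.map f (star x) := by
    rw [star_def, star_def, map_reverse, map_involute]
  rw [spinGroup.mem_iff, pinGroup.mem_iff]
  refine ⟨⟨?_, ?_⟩, ?_⟩
  · obtain ⟨u, hu, rfl⟩ := pinGroup.mem_lipschitzGroup (spinGroup.mem_pin hx)
    refine ⟨Units.map (CliffordAlgebra.map f : CliffordAlgebra Q₁ →* CliffordAlgebra Q₂) u, ?_, rfl⟩
    have hle : lipschitzGroup Q₁ ≤ (lipschitzGroup Q₂).comap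
        (Units.map (CliffordAlgebra.map f : CliffordAlgebra Q₁ →* CliffordAlgebra Q₂)) := by
      refine (Subgroup.closure_le _).2 ?_
      rintro w ⟨v, hv⟩
      refine Subgroup.subset_closure ⟨f v, ?_⟩
      simp [← hv]
    exact hle hu
  · rw [Unitary.mem_iff, hs, ← map_mul, ← map_mul, hU.1, hU.2]
    simp
  · have hx' := spinGroup.mem_even hx
    have : ∀ y : even Q₁, CliffordAlgebra.map f y ∈ even Q₂ := by
      rintro ⟨y, hy⟩
      change y ∈ evenOdd Q₁ 0 at hy
      change CliffordAlgebra.map f y ∈ evenOdd Q₂ 0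
      induction y, hy using CliffordAlgebra.even_induction with
      | algebraMap r =>
        rw [AlgHom.commutes]
        exact (even Q₂).algebraMap_mem r
      | add x y hx hy ihx ihy => rw [map_add]; exact add_mem ihx ihy
      | ι_mul_ι_mul m₁ m₂ x hx ih =>
        rw [map_mul, map_mul, map_apply_ι, map_apply_ι]
        exact (even Q₂).mul_mem (ι_mul_ι_mem_evenOdd_zero Q₂ _ _) ih
    exact this ⟨x, hx'⟩

/-- An isometry of quadratic spaces induces a homomorphism of Spin groups. -/
def spinMap (f : Q₁ →qᵢ Q₂) : spinGroup Q₁ →* spinGroup Q₂ where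
  toFun x := ⟨CliffordAlgebra.map f x, map_mem_spinGroup f x.2⟩
  map_one' := by ext; simp
  map_mul' x y := by ext; simp

/-- A product of two vectors of equal square `1` or `-1` lies in the Spin group. -/
theorem ι_mul_ι_mem_spinGroup (v w : W) (c : ℝ) (hc : c * c = 1)
    (hv : Q₂ v = c) (hw : Q₂ w = c) : ι Q₂ v * ι Q₂ w ∈ spinGroup Q₂ := by
  have hvec : ∀ u : W, Q₂ u = c → ι Q₂ u * (c • ι Q₂ u) = 1 ∧ (c • ι Q₂ u) * ι Q₂ u = 1 := by
    intro u hu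
    constructor
    · rw [mul_smul_comm, ι_sq_scalar, hu, Algebra.smul_def, ← map_mul, hc, map_one]
    · rw [smul_mul_assoc, ι_sq_scalar, hu, Algebra.smul_def, ← map_mul, hc, map_one]
  have hlip : ∀ u : W, Q₂ u = c →
      ∃ x ∈ lipschitzGroup Q₂, (x : CliffordAlgebra Q₂) = ι Q₂ u := by
    intro u hu
    exact ⟨⟨ι Q₂ u, c • ι Q₂ u, (hvec u hu).1, (hvec u hu).2⟩,
      Subgroup.subset_closure ⟨u, rfl⟩, rfl⟩
  obtain ⟨x, hx, hxv⟩ := hlip v hv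
  obtain ⟨y, hy, hyw⟩ := hlip w hw
  rw [spinGroup.mem_iff, pinGroup.mem_iff]
  refine ⟨⟨⟨x * y, mul_mem hx hy, by simp [hxv, hyw]⟩, ?_⟩, ι_mul_ι_mem_evenOdd_zero Q₂ v w⟩
  have hst : star (ι Q₂ v * ι Q₂ w) = ι Q₂ w * ι Q₂ v := by
    rw [star_mul, star_ι, star_ι, neg_mul_neg]
  rw [Unitary.mem_iff, hst]
  constructor
  · rw [mul_assoc, ← mul_assoc (ι Q₂ v), ι_sq_scalar, hv, Algebra.commutes, ← mul_assoc,
      ι_sq_scalar, hw, ← map_mul, hc, map_one]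
  · rw [mul_assoc, ← mul_assoc (ι Q₂ w), ι_sq_scalar, hw, Algebra.commutes, ← mul_assoc,
      ι_sq_scalar, hv, ← map_mul, hc, map_one]

end SpinMap

/-! ### The groups `K = Spin(n)`, `G = Spin₀(1,n)`, `M`, `A`, `N` -/

/-- The form `x ↦ -|x|²` on `ℝⁿ`; its Clifford algebra is `Cl(n)`, with `x y + y x = -2⟨x, y⟩`. -/
def euclForm (n : ℕ) : QuadraticForm ℝ (Fin n → ℝ) :=
  QuadraticMap.weightedSumSquares ℝ (fun _ => (-1 : ℝ))

/-- The form `x₀² - x₁² - ⋯ - xₙ²` on `ℝ^{1,n}`; in its Clifford algebra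
`x y + y x = 2 Q(x, y)`. -/
def lorentzForm (n : ℕ) : QuadraticForm ℝ (Fin (n + 1) → ℝ) :=
  QuadraticMap.weightedSumSquares ℝ (Fin.cons (1 : ℝ) (fun _ : Fin n => (-1 : ℝ)))

theorem euclForm_apply (n : ℕ) (x : Fin n → ℝ) : euclForm n x = -∑ i, x i * x i := by
  simp [euclForm, QuadraticMap.weightedSumSquares_apply]

theorem lorentzForm_apply (n : ℕ) (x : Fin (n + 1) → ℝ) :
    lorentzForm n x = x 0 * x 0 - ∑ i : Fin n, x i.succ * x i.succ := by
  simp [lorentzForm, QuadraticMap.weightedSumSquares_apply, Fin.sum_univ_succ, sub_eq_add_neg]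

/-- The inclusion `ℝⁿ → ℝ^{1,n}`, `x ↦ (0, x)`. -/
def inclLorentz (n : ℕ) : euclForm n →qᵢ lorentzForm n where
  toFun x := Fin.cons 0 x
  map_add' x y := by ext i; refine Fin.cases ?_ (fun j => ?_) i <;> simp
  map_smul' c x := by ext i; refine Fin.cases ?_ (fun j => ?_) i <;> simp
  map_app' x := by simp [lorentzForm_apply, euclForm_apply]

/-- The inclusion `ℝⁿ⁻¹ → ℝⁿ`, `x ↦ (x, 0)`. -/
def inclLast (n : ℕ) : euclForm (n - 1) →qᵢ euclForm n where
  toFun x := fun i => if h : (i : ℕ) < n - 1 then x ⟨i, h⟩ else 0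
  map_add' x y := by ext i; by_cases h : (i : ℕ) < n - 1 <;> simp [h]
  map_smul' c x := by ext i; by_cases h : (i : ℕ) < n - 1 <;> simp [h]
  map_app' x := by
    cases n with
    | zero => simp [euclForm_apply]
    | succ d =>
      simp only [euclForm_apply]
      rw [Fin.sum_univ_castSucc]
      simp

/-- `K = Spin(n)`: the even products of unit vectors of `ℝⁿ` in `Cl(n)`. -/
abbrev K (n : ℕ) : Type := spinGroup (euclForm n)

/-- `G = Spin₀(1,n)`: the products in the Clifford algebra of `ℝ^{1,n}` of an even number of vectors
with `Q = ±1`, an even number of them with `Q = -1`.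
(The condition `star g * g = 1` in `spinGroup` is `α(g) g = 1`, with `α` the Clifford conjugation.) -/
abbrev G (n : ℕ) : Type := spinGroup (lorentzForm n)

/-- The topology of `Spin(n)` as a subset of the finite-dimensional real vector space `Cl(n)`. -/
instance instTopologicalSpaceK (n : ℕ) : TopologicalSpace (K n) :=
  TopologicalSpace.induced (fun k : K n => (k : CliffordAlgebra (euclForm n)))
    (moduleTopology ℝ (CliffordAlgebra (euclForm n)))

instance instMeasurableSpaceK (n : ℕ) : MeasurableSpace (K n) := borel (K n)

instance instBorelSpaceK (n : ℕ) : BorelSpace (K n) := ⟨rfl⟩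

/-- The inclusion of `K` in `G`. -/
def inclK (n : ℕ) : K n →* G n := spinMap (inclLorentz n)

/-- `M = Spin(n-1)`, as a subgroup of `K`. -/
def M (n : ℕ) : Subgroup (K n) := (spinMap (inclLast n)).range

/-- The basis vectors `e₀, …, eₙ` of `ℝ^{1,n}` in its Clifford algebra. -/
def e {n : ℕ} (i : Fin (n + 1)) : CliffordAlgebra (lorentzForm n) :=
  ι (lorentzForm n) (Pi.single i 1)

/-- `a_t = cosh(t/2) + sinh(t/2) e₀eₙ = exp((t/2) e₀eₙ)`. It acts on `ℝ^{1,n}` by conjugation as a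
boost of hyperbolic length `t`, and `Ad(a_t) = e^t` on the Lie algebra of `N`. -/
def a {n : ℕ} [NeZero n] (t : ℝ) : G n :=
  ⟨algebraMap ℝ _ (Real.cosh (t / 2)) + Real.sinh (t / 2) • (e 0 * e (Fin.last n)), by
    have h0 : Fin.last n ≠ 0 := (Fin.last_pos' ).ne'
    have hv : lorentzForm n (Pi.single 0 1) = 1 := by
      simp [lorentzForm_apply]
    have hw : lorentzForm n (Real.cosh (t / 2) • (Pi.single 0 1 : Fin (n + 1) → ℝ)
        + Real.sinh (t / 2) • (Pi.single (Fin.last n) 1 : Fin (n + 1) → ℝ)) = 1 := by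
      obtain ⟨d, rfl⟩ := Nat.exists_eq_succ_of_ne_zero (NeZero.ne n)
      have hl : Fin.last (d + 1) = (Fin.last d).succ := rfl
      rw [lorentzForm_apply]
      have h1 := Real.cosh_sq (t / 2)
      have h2 : (0 : Fin (d + 1 + 1)) ≠ (Fin.last d).succ := (Fin.succ_ne_zero _).symm
      simp only [hl, Pi.add_apply, Pi.smul_apply, Pi.single_apply, Fin.succ_inj,
        Fin.succ_ne_zero, if_false, if_neg h2, smul_eq_mul, mul_ite, mul_one, mul_zero, ite_mul,
        zero_mul, zero_add, add_zero, if_true, Finset.sum_ite_eq', Finset.mem_univ]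
      linarith [sq (Real.cosh (t / 2)), sq (Real.sinh (t / 2))]
    have := ι_mul_ι_mem_spinGroup _ _ 1 (by norm_num) hv hw
    rw [map_add, map_smul, map_smul, mul_add, mul_smul_comm, mul_smul_comm, ι_sq_scalar, hv,
      map_one] at this
    rw [Algebra.algebraMap_eq_smul_one]
    exact this⟩

/-- `e₀ - eₙ` is a null vector. -/
theorem nil_sq {n : ℕ} [NeZero n] :
    (e 0 - e (Fin.last n)) * (e 0 - e (Fin.last n)) = (0 : CliffordAlgebra (lorentzForm n)) := by
  obtain ⟨d, rfl⟩ := Nat.exists_eq_succ_of_ne_zero (NeZero.ne n)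
  have h2 : (0 : Fin (d + 1 + 1)) ≠ (Fin.last d).succ := (Fin.succ_ne_zero _).symm
  have hl : Fin.last (d + 1) = (Fin.last d).succ := rfl
  rw [e, e, ← map_sub, ι_sq_scalar, lorentzForm_apply, hl, Finset.sum_eq_single (Fin.last d)]
  · simp
  · intro b _ hb
    simp [hb]
  · simp

theorem anticomm_nil {n : ℕ} [NeZero n] (x : Fin (n + 1) → ℝ) (h0 : x 0 = 0)
    (hn : x (Fin.last n) = 0) :
    (e 0 - e (Fin.last n)) * ι (lorentzForm n) x = -(ι _ x * (e 0 - e (Fin.last n))) := by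
  obtain ⟨d, rfl⟩ := Nat.exists_eq_succ_of_ne_zero (NeZero.ne n)
  have h2 : (0 : Fin (d + 1 + 1)) ≠ (Fin.last d).succ := (Fin.succ_ne_zero _).symm
  have hl : Fin.last (d + 1) = (Fin.last d).succ := rfl
  rw [e, e, ← map_sub]
  refine ι_mul_ι_comm_of_isOrtho ?_
  rw [QuadraticMap.isOrtho_def, lorentzForm_apply, lorentzForm_apply, lorentzForm_apply]
  have : ∀ y z : Fin (d + 1 + 1) → ℝ, (∑ i : Fin (d + 1), y i.succ * z i.succ = 0) → y 0 * z 0 = 0 →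
    (y + z) 0 * (y + z) 0 - ∑ i : Fin (d + 1), (y + z) i.succ * (y + z) i.succ
    = y 0 * y 0 - ∑ i : Fin (d + 1), y i.succ * y i.succ
      + (z 0 * z 0 - ∑ i : Fin (d + 1), z i.succ * z i.succ) := by
    intro y z h h'
    have : ∑ i : Fin (d + 1), (y + z) i.succ * (y + z) i.succ =
        ∑ i : Fin (d + 1), y i.succ * y i.succ + ∑ i : Fin (d + 1), z i.succ * z i.succ
        + 2 * ∑ i : Fin (d + 1), y i.succ * z i.succ := by
      rw [Finset.mul_sum, ← Finset.sum_add_distrib, ← Finset.sum_add_distrib]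
      refine Finset.sum_congr rfl fun i _ => ?_
      simp only [Pi.add_apply]; ring
    rw [this, h, Pi.add_apply]
    linear_combination 2 * h'
  refine this _ _ ?_ (by simp [h0])
  rw [hl, Finset.sum_eq_single (Fin.last d)]
  · rw [← hl, hn, mul_zero]
  · intro b _ hb
    simp [hb]
  · simp

/-- `N = exp(𝔫)`, `𝔫 = ⨁_{1 ≤ j ≤ n-1} ℝ e_j (e₀ - eₙ)`; here `exp(X) = 1 + X` because `X² = 0`. -/
def N (n : ℕ) [NeZero n] : Subgroup (G n) where
  carrier := {g | ∃ x : Fin (n + 1) → ℝ, x 0 = 0 ∧ x (Fin.last n) = 0 ∧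
    (g : CliffordAlgebra (lorentzForm n)) = 1 + ι _ x * (e 0 - e (Fin.last n))}
  one_mem' := ⟨0, by simp⟩
  mul_mem' := by
    rintro g h ⟨x, hx0, hxn, hg⟩ ⟨y, hy0, hyn, hh⟩
    refine ⟨x + y, by simp [hx0, hy0], by simp [hxn, hyn], ?_⟩
    rw [Submonoid.coe_mul, hg, hh, map_add]
    set w : CliffordAlgebra (lorentzForm n) := e 0 - e (Fin.last n) with hw
    have h1 : w * w = 0 := nil_sq
    have h2 : w * ι (lorentzForm n) y = -(ι _ y * w) := anticomm_nil y hy0 hyn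
    have h3 : ι (lorentzForm n) x * w * (ι _ y * w) = 0 := by
      rw [mul_assoc, ← mul_assoc w, h2, neg_mul, mul_assoc, h1, mul_zero, neg_zero, mul_zero]
    rw [mul_add, mul_one, add_mul, one_mul, h3, add_zero, add_mul, add_assoc]
  inv_mem' := by
    rintro g ⟨x, hx0, hxn, hg⟩
    refine ⟨-x, by simp [hx0], by simp [hxn], ?_⟩
    rw [← spinGroup.star_eq_inv, spinGroup.coe_star, hg, map_neg, neg_mul, ← anticomm_nil x hx0 hxn]
    simp only [e, star_add, star_one, star_mul, star_sub, star_ι]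
    congr 1
    noncomm_ring

/-- The Iwasawa decomposition `g = κ(g) a_{H(g)} n(g)`: the pair `(κ(g), H(g))`, where
`H(g) ∈ 𝔞 ≃ ℝ`. -/
def iwasawa {n : ℕ} [NeZero n] (g : G n) : K n × ℝ :=
  Classical.epsilon fun p : K n × ℝ => ∃ ν ∈ N n, g = inclK n p.1 * a p.2 * ν

/-- The component `κ(g) ∈ K`. -/
def kappa {n : ℕ} [NeZero n] (g : G n) : K n := (iwasawa g).1

/-- The component `H(g) ∈ 𝔞 ≃ ℝ`. -/
def H {n : ℕ} [NeZero n] (g : G n) : ℝ := (iwasawa g).2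

/-! ### The spin representations -/

/-- The spinor space `𝕊ₙ = ⋀ ℂᵐ`, `m = ⌊n/2⌋`, written in its orthonormal basis
`f_I = f_{i₁} ∧ ⋯ ∧ f_{i_k}`, `I = {i₁ < ⋯ < i_k}`. -/
abbrev Spinor (n : ℕ) : Type := EuclideanSpace ℂ (Finset (Fin (n / 2)))

/-- The sign with `f_j ∧ f_I = sgn j I • f_{I ∪ {j}}` for `j ∉ I`. -/
def sgn {m : ℕ} (j : Fin m) (I : Finset (Fin m)) : ℂ := (-1) ^ (I.filter (· < j)).card

/-- Exterior multiplication `x ↦ f_j ∧ x`. -/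
def creation {n : ℕ} (j : Fin (n / 2)) : Module.End ℂ (Spinor n) where
  toFun ψ := WithLp.toLp 2 fun I => if j ∈ I then sgn j (I.erase j) * ψ (I.erase j) else 0
  map_add' φ ψ := by ext I; by_cases h : j ∈ I <;> simp [h, mul_add]
  map_smul' c ψ := by ext I; by_cases h : j ∈ I <;> simp [h, mul_left_comm]

/-- Contraction with the dual vector of `f_j`, the adjoint of `creation j`:
`f_j ∧ f_I ↦ f_I` and `f_I ↦ 0` for `j ∉ I`. -/
def annihilation {n : ℕ} (j : Fin (n / 2)) : Module.End ℂ (Spinor n) where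
  toFun ψ := WithLp.toLp 2 fun I => if j ∈ I then 0 else sgn j I * ψ (insert j I)
  map_add' φ ψ := by ext I; by_cases h : j ∈ I <;> simp [h, mul_add]
  map_smul' c ψ := by ext I; by_cases h : j ∈ I <;> simp [h, mul_left_comm]

/-- The degree involution `x ↦ (-1)^{deg x} x`. -/
def parity (n : ℕ) : Module.End ℂ (Spinor n) where
  toFun ψ := WithLp.toLp 2 fun I => (-1) ^ I.card * ψ I
  map_add' φ ψ := by ext I; simp [mul_add]
  map_smul' c ψ := by ext I; simp [mul_left_comm]

/-- Clifford multiplication by the basis vectors of `ℝⁿ` (numbered from `0`), from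
`f_j = (e_{2j-1} + i e_{2j}) / √2 ↦ √2 f_j ∧ ·` and
`f̄_j = -(e_{2j-1} - i e_{2j}) / √2 ↦ √2 annihilation j`; for odd `n`, the last
basis vector acts by `i (-1)^{deg}`. -/
def gam {n : ℕ} (j : Fin n) : Module.End ℂ (Spinor n) :=
  if h : (j : ℕ) / 2 < n / 2 then
    if Even (j : ℕ) then creation ⟨j / 2, h⟩ - annihilation ⟨j / 2, h⟩
    else (-Complex.I) • (creation ⟨j / 2, h⟩ + annihilation ⟨j / 2, h⟩)
  else Complex.I • parity n

theorem sgn_mul_self {m : ℕ} (j : Fin m) (I : Finset (Fin m)) : sgn j I * sgn j I = 1 := by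
  rw [sgn, ← mul_pow]; simp

theorem sgn_insert {m : ℕ} (i j : Fin m) (I : Finset (Fin m)) (h : i ∉ I) :
    sgn j (insert i I) = (if i < j then -1 else 1) * sgn j I := by
  unfold sgn
  rw [Finset.filter_insert]
  split_ifs with hij
  · rw [Finset.card_insert_of_notMem (by simp [h]), pow_succ]; ring
  · simp

theorem sgn_erase {m : ℕ} (i j : Fin m) (I : Finset (Fin m)) (h : i ∈ I) :
    sgn j (I.erase i) = (if i < j then -1 else 1) * sgn j I := by
  have := sgn_insert i j (I.erase i) (Finset.notMem_erase i I)
  rw [Finset.insert_erase h] at this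
  rw [this]
  split_ifs <;> ring

theorem creation_apply {n : ℕ} (j : Fin (n / 2)) (ψ : Spinor n) (I : Finset (Fin (n / 2))) :
    creation j ψ I = if j ∈ I then sgn j (I.erase j) * ψ (I.erase j) else 0 := rfl

theorem annihilation_apply {n : ℕ} (j : Fin (n / 2)) (ψ : Spinor n) (I : Finset (Fin (n / 2))) :
    annihilation j ψ I = if j ∈ I then 0 else sgn j I * ψ (insert j I) := rfl

theorem parity_apply {n : ℕ} (ψ : Spinor n) (I : Finset (Fin (n / 2))) :
    parity n ψ I = (-1) ^ I.card * ψ I := rfl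

theorem creation_creation {n : ℕ} (i j : Fin (n / 2)) :
    (creation i * creation j + creation j * creation i : Module.End ℂ (Spinor n)) = 0 := by
  ext1 ψ; ext I
  simp only [LinearMap.add_apply, Module.End.mul_apply, PiLp.add_apply, creation_apply,
    LinearMap.zero_apply, PiLp.zero_apply]
  rcases eq_or_ne i j with rfl | hij
  · simp
  by_cases hi : i ∈ I <;> by_cases hj : j ∈ I <;>
    simp [hi, hj, hij, hij.symm]
  rw [sgn_erase j j (I.erase i) (by simp [hj, hij.symm]), sgn_erase i j I hi,
    sgn_erase i i (I.erase j) (by simp [hi, hij]), sgn_erase j i I hj,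
    sgn_erase i i I hi, sgn_erase j j I hj, Finset.erase_right_comm (a := j)]
  rcases lt_or_gt_of_ne hij with h | h <;> simp [h, h.not_gt] <;> ring

theorem annihilation_annihilation {n : ℕ} (i j : Fin (n / 2)) :
    (annihilation i * annihilation j + annihilation j * annihilation i :
      Module.End ℂ (Spinor n)) = 0 := by
  ext1 ψ; ext I
  simp only [LinearMap.add_apply, Module.End.mul_apply, PiLp.add_apply, annihilation_apply,
    LinearMap.zero_apply, PiLp.zero_apply]
  rcases eq_or_ne i j with rfl | hij
  · simp
  by_cases hi : i ∈ I <;> by_cases hj : j ∈ I <;>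
    simp [hi, hj, hij, hij.symm]
  rw [Finset.insert_comm j i, sgn_insert i j I hi, sgn_insert j i I hj]
  rcases lt_or_gt_of_ne hij with h | h <;> simp [h, h.not_gt] <;> ring

theorem creation_annihilation {n : ℕ} (i j : Fin (n / 2)) :
    (creation i * annihilation j + annihilation j * creation i : Module.End ℂ (Spinor n)) =
      if i = j then 1 else 0 := by
  ext1 ψ; ext I
  simp only [LinearMap.add_apply, Module.End.mul_apply, PiLp.add_apply, annihilation_apply,
    creation_apply]
  rcases eq_or_ne i j with rfl | hij
  · by_cases hi : i ∈ I
    · simp [hi, ← mul_assoc, sgn_mul_self]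
    · simp [hi, ← mul_assoc, sgn_mul_self]
  by_cases hi : i ∈ I <;> by_cases hj : j ∈ I <;>
    simp [hi, hj, hij, hij.symm]
  rw [Finset.erase_insert_of_ne hij.symm, sgn_insert j i _ (by simp [hj]),
    sgn_erase i j I hi]
  rcases lt_or_gt_of_ne hij with h | h <;> simp [h, h.not_gt] <;> ring

theorem parity_creation {n : ℕ} (j : Fin (n / 2)) :
    parity n * creation j = -(creation j * parity n) := by
  ext1 ψ; ext I
  simp only [LinearMap.neg_apply, Module.End.mul_apply, PiLp.neg_apply, creation_apply,
    parity_apply]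
  by_cases hj : j ∈ I
  · have : I.card = (I.erase j).card + 1 := (Finset.card_erase_add_one hj).symm
    rw [this, pow_succ]
    simp [hj]
    ring
  · simp [hj]

theorem parity_annihilation {n : ℕ} (j : Fin (n / 2)) :
    parity n * annihilation j = -(annihilation j * parity n) := by
  ext1 ψ; ext I
  simp only [LinearMap.neg_apply, Module.End.mul_apply, PiLp.neg_apply, annihilation_apply,
    parity_apply]
  by_cases hj : j ∈ I
  · simp [hj]
  · simp [hj, pow_succ]
    ring

theorem parity_parity (n : ℕ) : parity n * parity n = 1 := by
  ext1 ψ; ext I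
  simp only [Module.End.mul_apply, parity_apply, ← mul_assoc, ← mul_pow]
  simp

/-- The Clifford relations `e_i e_j + e_j e_i = -2 δ_{ij}`. -/
theorem gam_gam {n : ℕ} (i j : Fin n) :
    (gam i * gam j + gam j * gam i : Module.End ℂ (Spinor n)) = if i = j then -2 else 0 := by
  have key : ∀ p q : Fin (n / 2),
      ((creation p - annihilation p) * (creation q - annihilation q)
        + (creation q - annihilation q) * (creation p - annihilation p) :
        Module.End ℂ (Spinor n)) = (if p = q then -2 else 0) ∧
      ((creation p + annihilation p) * (creation q + annihilation q)
        + (creation q + annihilation q) * (creation p + annihilation p) :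
        Module.End ℂ (Spinor n)) = (if p = q then 2 else 0) ∧
      ((creation p - annihilation p) * (creation q + annihilation q)
        + (creation q + annihilation q) * (creation p - annihilation p) :
        Module.End ℂ (Spinor n)) = 0 := by
    intro p q
    have h1 := creation_creation p q
    have h2 := annihilation_annihilation p q
    have h3 := creation_annihilation p q
    have h4 := creation_annihilation q p
    simp only [eq_comm (a := q) (b := p)] at h4
    refine ⟨?_, ?_, ?_⟩
    · have : ((creation p - annihilation p) * (creation q - annihilation q)
        + (creation q - annihilation q) * (creation p - annihilation p) :
        Module.End ℂ (Spinor n)) = (creation p * creation q + creation q * creation p)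
          + (annihilation p * annihilation q + annihilation q * annihilation p)
          - (creation p * annihilation q + annihilation q * creation p)
          - (creation q * annihilation p + annihilation p * creation q) := by noncomm_ring
      rw [this, h1, h2, h3, h4]
      split_ifs <;> norm_num
    · have : ((creation p + annihilation p) * (creation q + annihilation q)
        + (creation q + annihilation q) * (creation p + annihilation p) :
        Module.End ℂ (Spinor n)) = (creation p * creation q + creation q * creation p)
          + (annihilation p * annihilation q + annihilation q * annihilation p)
          + (creation p * annihilation q + annihilation q * creation p)
          + (creation q * annihilation p + annihilation p * creation q) := by noncomm_ring
      rw [this, h1, h2, h3, h4]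
      split_ifs <;> norm_num
    · have : ((creation p - annihilation p) * (creation q + annihilation q)
        + (creation q + annihilation q) * (creation p - annihilation p) :
        Module.End ℂ (Spinor n)) = (creation p * creation q + creation q * creation p)
          - (annihilation p * annihilation q + annihilation q * annihilation p)
          + (creation p * annihilation q + annihilation q * creation p)
          - (creation q * annihilation p + annihilation p * creation q) := by noncomm_ring
      rw [this, h1, h2, h3, h4]
      simp
  have hI : (-Complex.I) * (-Complex.I) = -1 := by simp
  have hI' : Complex.I * Complex.I = -1 := by simp
  have hpar : ∀ p : Fin (n / 2),
      (creation p - annihilation p) * parity n + parity n * (creation p - annihilation p) = 0 ∧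
      (creation p + annihilation p) * parity n + parity n * (creation p + annihilation p) = 0 := by
    intro p
    have h1 := parity_creation p
    have h2 := parity_annihilation p
    constructor
    · rw [mul_sub, h1, h2]; noncomm_ring
    · rw [mul_add, h1, h2]; noncomm_ring
  unfold gam
  by_cases hi : (i : ℕ) / 2 < n / 2 <;> by_cases hj : (j : ℕ) / 2 < n / 2
  · rw [dif_pos hi, dif_pos hj]
    obtain ⟨k1, k2, k3⟩ := key ⟨i / 2, hi⟩ ⟨j / 2, hj⟩
    obtain ⟨l1, l2, l3⟩ := key ⟨j / 2, hj⟩ ⟨i / 2, hi⟩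
    by_cases ei : Even (i : ℕ) <;> by_cases ej : Even (j : ℕ)
    · rw [if_pos ei, if_pos ej, k1]
      refine if_congr ?_ rfl rfl
      rw [Fin.ext_iff, Fin.ext_iff]
      rw [Nat.even_iff] at ei ej
      simp only; omega
    · rw [if_pos ei, if_neg ej, if_neg (by rintro rfl; exact ej ei), mul_smul_comm, smul_mul_assoc,
        ← smul_add, k3, smul_zero]
    · rw [if_neg ei, if_pos ej, if_neg (by rintro rfl; exact ei ej), mul_smul_comm, smul_mul_assoc,
        ← smul_add, add_comm, l3, smul_zero]
    · rw [if_neg ei, if_neg ej, smul_mul_smul_comm, smul_mul_smul_comm, hI, ← smul_add, k2]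
      have : ((⟨i / 2, hi⟩ : Fin (n / 2)) = ⟨j / 2, hj⟩) ↔ i = j := by
        rw [Fin.ext_iff, Fin.ext_iff]
        rw [Nat.even_iff] at ei ej
        simp only; omega
      simp only [this]
      split_ifs <;> simp
  · rw [dif_pos hi, dif_neg hj, if_neg (show i ≠ j by rintro rfl; exact hj hi)]
    by_cases ei : Even (i : ℕ) <;> simp only [ei, if_true, if_false]
    · rw [mul_smul_comm, smul_mul_assoc, ← smul_add, (hpar _).1, smul_zero]
    · rw [smul_mul_smul_comm, smul_mul_smul_comm, mul_comm Complex.I, ← smul_add, (hpar _).2,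
        smul_zero]
  · rw [dif_neg hi, dif_pos hj, if_neg (show i ≠ j by rintro rfl; exact hi hj)]
    by_cases ej : Even (j : ℕ) <;> simp only [ej, if_true, if_false]
    · rw [mul_smul_comm, smul_mul_assoc, ← smul_add, add_comm, (hpar _).1, smul_zero]
    · rw [smul_mul_smul_comm, smul_mul_smul_comm, mul_comm Complex.I, ← smul_add, add_comm,
        (hpar _).2, smul_zero]
  · rw [dif_neg hi, dif_neg hj, if_pos (by apply Fin.ext; omega), smul_mul_smul_comm, hI',
      parity_parity, ← add_smul, show (-1 + -1 : ℂ) = -2 by norm_num, Algebra.smul_def, mul_one,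
      map_neg, map_ofNat]

/-- Clifford multiplication by vectors of `ℝⁿ` on spinors. -/
def cliffordMul (n : ℕ) : (Fin n → ℝ) →ₗ[ℝ] Module.End ℂ (Spinor n) where
  toFun x := ∑ j, (x j : ℂ) • gam j
  map_add' x y := by simp [add_smul, Finset.sum_add_distrib]
  map_smul' c x := by simp [mul_smul, Finset.smul_sum]

theorem cliffordMul_sq (n : ℕ) (x : Fin n → ℝ) :
    cliffordMul n x * cliffordMul n x = algebraMap ℝ _ (euclForm n x) := by
  have h2 : cliffordMul n x * cliffordMul n x + cliffordMul n x * cliffordMul n x =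
      algebraMap ℝ _ (euclForm n x) + algebraMap ℝ _ (euclForm n x) := by
    have h1 : cliffordMul n x * cliffordMul n x =
        ∑ i, ∑ j, ((x i : ℂ) * x j) • (gam i * gam j : Module.End ℂ (Spinor n)) := by
      simp only [cliffordMul, LinearMap.coe_mk, AddHom.coe_mk, Finset.sum_mul_sum,
        smul_mul_smul_comm]
    have h1' : cliffordMul n x * cliffordMul n x =
        ∑ i, ∑ j, ((x i : ℂ) * x j) • (gam j * gam i : Module.End ℂ (Spinor n)) := by
      rw [h1, Finset.sum_comm]
      simp only [mul_comm]
    conv_lhs => rw [h1]; rhs; rw [← h1, h1']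
    rw [← Finset.sum_add_distrib]
    simp only [← Finset.sum_add_distrib, ← smul_add, gam_gam]
    simp only [smul_ite, smul_zero, Finset.sum_ite_eq, Finset.mem_univ, if_true]
    rw [euclForm_apply, ← map_add, ← Finset.sum_smul, Algebra.algebraMap_eq_smul_one]
    have : (-2 : Module.End ℂ (Spinor n)) = (-2 : ℂ) • 1 := by
      rw [Algebra.smul_def, mul_one, map_neg, map_ofNat]
    rw [this, smul_smul, ← Complex.coe_smul]
    congr 1
    push_cast
    ring
  have h3 := congrArg (fun y => (1 / 2 : ℝ) • y) h2
  simpa [← two_smul ℝ, smul_smul] using h3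

/-- The action of `Cl(n)` on spinors. -/
def cliffordRep (n : ℕ) : CliffordAlgebra (euclForm n) →ₐ[ℝ] Module.End ℂ (Spinor n) :=
  CliffordAlgebra.lift (euclForm n) ⟨cliffordMul n, cliffordMul_sq n⟩

/-- The spin representation `τₙ` of `Spin(n)` on `𝕊ₙ`. -/
def spinRep (n : ℕ) : Representation ℂ (K n) (Spinor n) where
  toFun k := cliffordRep n k
  map_one' := by simp
  map_mul' k l := by simp

/-- The half-spinor space `𝕊⁺ = ⋀⁺` (`s = 1`) or `𝕊⁻ = ⋀⁻` (`s = -1`). -/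
def halfSpinor (n : ℕ) (s : ℤˣ) : Submodule ℂ (Spinor n) where
  carrier := {ψ | ∀ I, (-1 : ℤˣ) ^ I.card ≠ s → ψ I = 0}
  add_mem' h h' I hI := by simp [h I hI, h' I hI]
  zero_mem' I _ := by simp
  smul_mem' c ψ h I hI := by simp [h I hI]

/-- The space `V_τ`: `𝕊ₙ^±` if `n` is even, `𝕊ₙ` if `n` is odd. -/
def Vtau (n : ℕ) (s : ℤˣ) : Submodule ℂ (Spinor n) := if Even n then halfSpinor n s else ⊤

theorem parity_cliffordRep {n : ℕ} (hn : Even n) (x : CliffordAlgebra (euclForm n)) :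
    parity n * cliffordRep n x = cliffordRep n (involute x) * parity n := by
  have hg : ∀ j : Fin n, parity n * gam j = -(gam j * parity n) := by
    intro j
    have hj : (j : ℕ) / 2 < n / 2 := by
      rw [Nat.even_iff] at hn
      omega
    unfold gam
    rw [dif_pos hj]
    split_ifs
    · rw [mul_sub, sub_mul, parity_creation, parity_annihilation]; abel
    · rw [mul_smul_comm, smul_mul_assoc, mul_add, add_mul, parity_creation, parity_annihilation,
        ← smul_neg]
      congr 1
      abel
  induction x using CliffordAlgebra.induction with
  | algebraMap r =>
    rw [AlgHom.commutes, AlgHom.commutes, AlgHom.commutes, Algebra.commutes]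
  | ι v =>
    rw [involute_ι, map_neg, neg_mul]
    simp only [cliffordRep, lift_ι_apply, cliffordMul, LinearMap.coe_mk, AddHom.coe_mk,
      Finset.mul_sum, Finset.sum_mul, mul_smul_comm, smul_mul_assoc, hg, smul_neg,
      Finset.sum_neg_distrib]
  | mul a b ha hb => rw [map_mul, map_mul, map_mul, ← mul_assoc, ha, mul_assoc, hb, mul_assoc]
  | add a b ha hb => rw [map_add, map_add, map_add, mul_add, add_mul, ha, hb]

theorem mem_halfSpinor_iff {n : ℕ} {s : ℤˣ} {ψ : Spinor n} :
    ψ ∈ halfSpinor n s ↔ parity n ψ = ((s : ℤ) : ℂ) • ψ := by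
  have hs : ∀ I : Finset (Fin (n / 2)), ((-1 : ℂ) ^ I.card) = (((-1 : ℤˣ) ^ I.card : ℤˣ) : ℤ) := by
    intro I; push_cast; simp
  constructor
  · intro h
    ext I
    rw [parity_apply, PiLp.smul_apply, smul_eq_mul, hs]
    by_cases hI : (-1 : ℤˣ) ^ I.card = s
    · rw [hI]
    · rw [h I hI, mul_zero, mul_zero]
  · intro h I hI
    have h1 : parity n ψ I = (((s : ℤ) : ℂ) • ψ) I := by rw [h]
    rw [parity_apply, PiLp.smul_apply, smul_eq_mul, hs] at h1
    have h2 : (((((-1 : ℤˣ) ^ I.card : ℤˣ) : ℤ) : ℂ) - ((s : ℤ) : ℂ)) * ψ I = 0 := by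
      rw [sub_mul, h1, sub_self]
    rcases mul_eq_zero.1 h2 with h3 | h3
    · exact absurd (Units.ext (by exact_mod_cast sub_eq_zero.1 h3)) hI
    · exact h3

theorem spinRep_mem_Vtau {n : ℕ} {s : ℤˣ} (k : K n) {ψ : Spinor n} (h : ψ ∈ Vtau n s) :
    spinRep n k ψ ∈ Vtau n s := by
  unfold Vtau at h ⊢
  split_ifs at h ⊢ with hn
  · rw [mem_halfSpinor_iff] at h ⊢
    have h1 := LinearMap.congr_fun (parity_cliffordRep hn (k : CliffordAlgebra (euclForm n))) ψ
    rw [spinGroup.involute_eq k.2, Module.End.mul_apply, Module.End.mul_apply, h, map_smul] at h1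
    exact h1
  · trivial

/-- The representation `τ` of `K = Spin(n)` on `V_τ`: the half-spin representation `τₙ^±` if `n` is
even (`s = ±1`), the spin representation `τₙ` if `n` is odd. -/
def tau (n : ℕ) (s : ℤˣ) : Representation ℂ (K n) (Vtau n s) where
  toFun k := (spinRep n k).restrict fun _ h => spinRep_mem_Vtau k h
  map_one' := by ext; simp
  map_mul' k l := by ext; simp

/-! ### Poisson transforms -/

section Poisson

variable {n : ℕ} {s : ℤˣ} {V : Type*} [NormedAddCommGroup V] [InnerProductSpace ℂ V]

/-- `ρ = (n - 1) / 2`. -/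
def rho (n : ℕ) : ℝ := ((n : ℝ) - 1) / 2

/-- The constant `√(dim τ / dim σ)`, where `V` is the space of `σ`. -/
def slashKappa (n : ℕ) (s : ℤˣ) (V : Type*) [NormedAddCommGroup V] [InnerProductSpace ℂ V] : ℝ :=
  Real.sqrt ((Module.finrank ℂ (Vtau n s) : ℝ) / (Module.finrank ℂ V : ℝ))

/-- `σ ∈ M̂(τ)`: `σ` is an irreducible representation of `M = Spin(n-1)` that occurs in `τ|_M`, with
`ι : V_σ → V_τ` an isometric `M`-equivariant embedding (so that `σ` is unitary). -/
structure IsConstituent (σ : Representation ℂ (M n) V) (ι : V →ₗᵢ[ℂ] Vtau n s) : Prop where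
  irreducible : σ.IsIrreducible
  equivariant : ∀ (m : M n) (v : V), ι (σ m v) = tau n s m (ι v)

/-- `f ∈ L^p(K/M, σ)`: `f` is a `p`-integrable function on `K` with `f(km) = σ(m⁻¹) f(k)`. As for
elements of an `L^p` space, equality is almost everywhere in `k`, for each `m`. -/
structure IsLpSection (μ : Measure (K n)) (p : ℝ) (σ : Representation ℂ (M n) V) (f : K n → V) :
    Prop where
  memLp : MemLp f (ENNReal.ofReal p) μ
  covariant : ∀ m : M n, ∀ᵐ k ∂μ, f (k * m) = σ m⁻¹ (f k)

/-- The norm `(∫_K ‖f(k)‖^p dk)^{1/p}`. -/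
def normLp (μ : Measure (K n)) (p : ℝ) (f : K n → V) : ℝ := (∫ k, ‖f k‖ ^ p ∂μ) ^ (1 / p)

variable [NeZero n]

/-- The integrand `k ↦ e^{-(iλ+ρ) H(g⁻¹k)} τ(κ(g⁻¹k)) ι(f(k))` of the Poisson transform. -/
def poissonIntegrand (ι : V →ₗᵢ[ℂ] Vtau n s) (lam : ℂ) (f : K n → V) (g : G n) (k : K n) :
    Vtau n s :=
  Complex.exp (-(Complex.I * lam + rho n) * H (g⁻¹ * inclK n k)) •
    tau n s (kappa (g⁻¹ * inclK n k)) (ι (f k))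

/-- The Poisson transform `P f(g) = √(dim τ / dim σ) ∫_K e^{-(iλ+ρ) H(g⁻¹k)} τ(κ(g⁻¹k)) ι(f(k)) dk`. -/
def poisson (μ : Measure (K n)) (ι : V →ₗᵢ[ℂ] Vtau n s) (lam : ℂ) (f : K n → V) (g : G n) :
    Vtau n s :=
  slashKappa n s V • ∫ k, poissonIntegrand ι lam f g k ∂μ

end Poisson

end SpinPoisson

end

/-!
The transform is dominated by a convolution with a positive zonal kernel on `K`, whose mass is a
spherical function; the proposition is Schur's test together with the growth of that function.

*Reduction to a kernel.* As `τ` is unitary and `ι` isometric, `‖P f(k a_t)‖` is at most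
`√(dim τ / dim σ)` times `∫ e^{-s H(a_{-t} k⁻¹ h)} ‖f(h)‖ dh`, with `s = Re(iλ) + ρ`. Let
`axis k = k eₙ k⁻¹`, a point of the unit sphere of `ℝⁿ`. Then
`e^{H(a_{-t} k⁻¹ h)} = cosh t - sinh t ⟨axis k, axis h⟩` (`exp_H_a_mul`, `axis_inv_mul`). This is
symmetric in `k` and `h`, so left invariance of the measure bounds both marginals of the kernel, and
Schur's test (`lintegral_rpow_schur`) gives the bound on `L^p` with the mass
`∫ (cosh t - sinh t ⟨eₙ, axis h⟩)^{-s} dh` as constant.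

*The mass of the kernel* (`exists_lintegral_zonal_le`). By invariance, `eₙ` may be replaced by any
point `axis k`, hence by any point `(z, √(1 - |z|²))` with `z` in a small ball of `ℝⁿ⁻¹`, and then
averaged over `z`. After Fubini, the inner integral in `z` is bounded pointwise in `h`, because
`cosh t - sinh t ⟨u, v⟩` is at least `e^{-t} (1 + e^t |u' - v'|)² / 16` for unit vectors `u`, `v`
with projections `u'`, `v'` to `ℝⁿ⁻¹` (`zonal_le`). Scaling by `e^t` gives `e^{(s - (n-1)) t}` times
the integral of `(1 + |z|)^{-2s}` over `ℝⁿ⁻¹`. That is finite since `2s = 2 Re(iλ) + (n-1) > n-1`, and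
`s - (n-1) = Re(iλ) - ρ`. No formula for the Haar measure of `K` is needed.

*The Iwasawa projections.* They are controlled through the null vector `w = e₀ - eₙ` of `Cl(1,n)`,
which satisfies `g w = e^{H(g)/2} κ(g) w` (`coe_mul_nul`). For the existence of the decomposition
(`exists_iwasawa`), a product `g` of vectors of `ℝ^{1,n}` satisfies `g w = c w` with `c` a product
of vectors of `ℝⁿ` (`exists_lipschitz_mul_nul`); normalizing `c` gives `κ(g)` and `H(g)`, and the
elements of `G` that fix `w` under left multiplication are those of `N` (`mem_N_of_mul_nul`). In the
representation of `Cl(1,n)` on two copies of the spinors, the identity exhibits `e^{H(g)/2} τ(κ(g))`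
as a block of the matrix of `g` (`lorentzRep_nulSpinor`), whence the measurability of the integrand
and the boundedness of `e^{-s H(g⁻¹k)}` in `k`, for every `g`.
-/

noncomputable section

namespace SpinPoisson

/-! ### Units of Clifford algebras over `ℝ` -/

section Units

variable {V : Type*} [AddCommGroup V] [Module ℝ V] {Q : QuadraticForm ℝ V}

theorem algebraMap_clifford_injective :
    Function.Injective (algebraMap ℝ (CliffordAlgebra Q)) :=
  FaithfulSMul.algebraMap_injective ℝ _

/-- A vector that is invertible in the Clifford algebra is anisotropic. -/
theorem form_ne_zero_of_unit {x : (CliffordAlgebra Q)ˣ} {v : V} (h : ι Q v = x) : Q v ≠ 0 := by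
  intro h0
  have h1 : (x : CliffordAlgebra Q) * x = 0 := by rw [← h, ι_sq_scalar, h0, map_zero]
  have h2 : (x * x : (CliffordAlgebra Q)ˣ).val = 0 := h1
  exact (x * x).ne_zero h2

/-- An anisotropic vector, as a unit of the Clifford algebra. -/
def vecUnit (v : V) (h : Q v ≠ 0) : (CliffordAlgebra Q)ˣ where
  val := ι Q v
  inv := ι Q ((Q v)⁻¹ • v)
  val_inv := by
    rw [map_smul, mul_smul_comm, ι_sq_scalar, Algebra.smul_def, ← map_mul, inv_mul_cancel₀ h,
      map_one]
  inv_val := by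
    rw [map_smul, smul_mul_assoc, ι_sq_scalar, Algebra.smul_def, ← map_mul, inv_mul_cancel₀ h,
      map_one]

theorem vecUnit_mem (v : V) (h : Q v ≠ 0) : vecUnit v h ∈ lipschitzGroup Q :=
  Subgroup.subset_closure ⟨v, rfl⟩

/-- Induction on the number of factors, for products of anisotropic vectors. -/
theorem lipschitz_induction {p : (CliffordAlgebra Q)ˣ → Prop} (one : p 1)
    (mul : ∀ (v : V) (h : Q v ≠ 0) (y : (CliffordAlgebra Q)ˣ), y ∈ lipschitzGroup Q → p y →
      p (vecUnit v h * y))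
    {x : (CliffordAlgebra Q)ˣ} (hx : x ∈ lipschitzGroup Q) : p x := by
  unfold lipschitzGroup at hx
  induction hx using Subgroup.closure_induction_left with
  | one => exact one
  | mul_left x hx y hy ih =>
    obtain ⟨v, hv⟩ := hx
    have : x = vecUnit v (form_ne_zero_of_unit hv) := Units.ext hv.symm
    rw [this]
    exact mul _ _ _ hy ih
  | inv_mul_cancel x hx y hy ih =>
    obtain ⟨v, hv⟩ := hx
    have hv0 := form_ne_zero_of_unit hv
    have h1 : Q ((Q v)⁻¹ • v) ≠ 0 := by
      rw [QuadraticMap.map_smul, smul_eq_mul]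
      exact mul_ne_zero (mul_ne_zero (inv_ne_zero hv0) (inv_ne_zero hv0)) hv0
    have : x⁻¹ = vecUnit ((Q v)⁻¹ • v) h1 := by
      have h2 : x = vecUnit v hv0 := Units.ext hv.symm
      rw [h2]
      exact Units.ext rfl
    rw [this]
    exact mul _ _ _ hy ih

theorem even_or_odd_of_lipschitz {x : (CliffordAlgebra Q)ˣ} (hx : x ∈ lipschitzGroup Q) :
    (x : CliffordAlgebra Q) ∈ evenOdd Q 0 ∨ (x : CliffordAlgebra Q) ∈ evenOdd Q 1 := by
  refine lipschitz_induction (p := fun x => (x : CliffordAlgebra Q) ∈ evenOdd Q 0 ∨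
    (x : CliffordAlgebra Q) ∈ evenOdd Q 1) (Or.inl ?_) ?_ hx
  · exact (even Q).one_mem
  · intro v h y _ ih
    have hm : ∀ i, (y : CliffordAlgebra Q) ∈ evenOdd Q i → ι Q v * y ∈ evenOdd Q (1 + i) :=
      fun i hi => SetLike.mul_mem_graded (ι_mem_evenOdd_one Q v) hi
    rcases ih with ih | ih
    · right; exact hm 0 ih
    · left; exact hm 1 ih

end Units

/-- `Cl(n)`, `n = d + 1`. -/
abbrev ClE (d : ℕ) : Type := CliffordAlgebra (euclForm (d + 1))

/-- `Cl(1,n)`, `n = d + 1`. -/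
abbrev ClL (d : ℕ) : Type := CliffordAlgebra (lorentzForm (d + 1))

/-! ### The Iwasawa decomposition -/

section Iwasawa

variable {d : ℕ}

theorem euclForm_neg {n : ℕ} {v : Fin n → ℝ} (hv : v ≠ 0) : euclForm n v < 0 := by
  rw [euclForm_apply, neg_lt_zero]
  obtain ⟨i, hi⟩ := Function.ne_iff.1 hv
  exact Finset.sum_pos' (fun i _ => mul_self_nonneg _)
    ⟨i, Finset.mem_univ _, mul_self_pos.2 hi⟩

/-- The last basis vector of `ℝⁿ`, `n = d + 1`. -/
abbrev lastVec (d : ℕ) : Fin (d + 1) → ℝ := Pi.single (Fin.last d) 1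

theorem euclForm_lastVec : euclForm (d + 1) (lastVec d) = -1 := by
  simp [euclForm_apply, Pi.single_apply]

/-- The null vector `e₀ - eₙ`, `n = d + 1`. -/
def nul (d : ℕ) : ClL d := e 0 - e (Fin.last (d + 1))

/-- The inclusion `Cl(n) → Cl(1,n)`, `n = d + 1`. -/
abbrev inclCl (d : ℕ) :
    ClE d →ₐ[ℝ] ClL d :=
  CliffordAlgebra.map (inclLorentz (d + 1))

theorem coe_inclK {n : ℕ} (k : K n) :
    ((inclK n k : G n) : CliffordAlgebra (lorentzForm n)) =
      CliffordAlgebra.map (inclLorentz n) k := rfl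

theorem inclCl_lastVec : inclCl d (ι _ (lastVec d)) = e (Fin.last (d + 1)) := by
  rw [map_apply_ι, e]
  congr 1
  change (Fin.cons 0 (lastVec d) : Fin (d + 1 + 1) → ℝ) = _
  ext i
  refine Fin.cases ?_ (fun j => ?_) i
  · simp
  · rw [Fin.cons_succ, ← Fin.succ_last, lastVec, Pi.single_apply, Pi.single_apply]
    simp only [Fin.succ_inj]

theorem ι_lorentz (v : Fin (d + 1 + 1) → ℝ) :
    ι (lorentzForm (d + 1)) v = v 0 • e 0 + inclCl d (ι _ (Fin.tail v)) := by
  rw [map_apply_ι, e, ← map_smul, ← map_add]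
  congr 1
  change v = v 0 • Pi.single 0 1 + (Fin.cons 0 (Fin.tail v) : Fin (d + 1 + 1) → ℝ)
  ext i
  refine Fin.cases ?_ (fun j => ?_) i
  · simp
  · simp [Fin.tail]

theorem e_zero_sq : (e 0 * e 0 : ClL d) = 1 := by
  rw [e, ι_sq_scalar, lorentzForm_apply]
  simp

theorem e_last_sq : (e (Fin.last (d + 1)) * e (Fin.last (d + 1)) :
    ClL d) = -1 := by
  rw [← inclCl_lastVec, ← map_mul, ι_sq_scalar, euclForm_lastVec, map_neg, map_neg, map_one,
    map_one]

theorem e_zero_mul_inclCl (x : ClE d) :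
    e 0 * inclCl d x = inclCl d (involute x) * e 0 := by
  induction x using CliffordAlgebra.induction with
  | algebraMap r => simp only [AlgHom.commutes, Algebra.commutes]
  | ι v =>
    rw [involute_ι, map_neg, map_apply_ι, e, neg_mul]
    refine ι_mul_ι_comm_of_isOrtho ?_
    change lorentzForm (d + 1) (Pi.single 0 1 + (Fin.cons 0 v : Fin (d + 1 + 1) → ℝ)) =
      lorentzForm (d + 1) (Pi.single 0 1) + lorentzForm (d + 1) (Fin.cons 0 v)
    simp only [lorentzForm_apply]
    simp [sub_eq_add_neg]
  | mul a b ha hb => rw [map_mul, map_mul, map_mul, ← mul_assoc, ha, mul_assoc, hb, mul_assoc]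
  | add a b ha hb => rw [map_add, map_add, map_add, mul_add, add_mul, ha, hb]

theorem e_zero_mul_e_last : (e 0 * e (Fin.last (d + 1)) :
    ClL d) = -(e (Fin.last (d + 1)) * e 0) := by
  rw [← inclCl_lastVec, e_zero_mul_inclCl, involute_ι, map_neg, neg_mul]

theorem e_zero_mul_nul : e 0 * nul d = inclCl d (ι _ (lastVec d)) * nul d := by
  rw [inclCl_lastVec, nul, mul_sub, mul_sub, e_zero_sq, e_last_sq, e_zero_mul_e_last]
  abel

theorem nul_mul_e_zero_add : nul d * e 0 + e 0 * nul d = 2 := by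
  rw [nul, sub_mul, mul_sub, e_zero_sq, e_zero_mul_e_last, sub_neg_eq_add, sub_add_add_cancel]
  exact one_add_one_eq_two

theorem nul_ne_zero : nul d ≠ 0 := by
  intro h
  have h1 := nul_mul_e_zero_add (d := d)
  rw [h, mul_zero, zero_mul, add_zero] at h1
  have : (2 : ClL d) = algebraMap ℝ _ 2 := (map_ofNat _ 2).symm
  rw [this, ← map_zero (algebraMap ℝ _)] at h1
  exact two_ne_zero (algebraMap_clifford_injective h1).symm

theorem star_nul : star (nul d) = -nul d := by
  simp only [nul, e, star_sub, star_ι]; abel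

theorem coe_a (t : ℝ) : ((a t : G (d + 1)) : ClL d) =
    algebraMap ℝ _ (Real.cosh (t / 2)) + Real.sinh (t / 2) • (e 0 * e (Fin.last (d + 1))) := rfl

theorem e_zero_mul_e_last_mul_nul : e 0 * e (Fin.last (d + 1)) * nul d = nul d := by
  rw [mul_assoc, ← inclCl_lastVec, ← e_zero_mul_nul, ← mul_assoc, e_zero_sq, one_mul]

theorem a_mul_nul (t : ℝ) :
    ((a t : G (d + 1)) : ClL d) * nul d =
      Real.exp (t / 2) • nul d := by
  rw [coe_a, add_mul, smul_mul_assoc, e_zero_mul_e_last_mul_nul, ← Algebra.smul_def, ← add_smul,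
    Real.cosh_add_sinh]

theorem a_neg (t : ℝ) : (a (-t) : G (d + 1)) = (a t)⁻¹ := by
  rw [← spinGroup.star_eq_inv]
  ext
  rw [spinGroup.coe_star, coe_a, coe_a]
  rw [star_add, CliffordAlgebra.star_smul, star_mul, star_algebraMap, e, e, star_ι, star_ι,
    neg_mul_neg, neg_div, Real.cosh_neg, Real.sinh_neg, ← e, ← e, e_zero_mul_e_last, smul_neg,
    neg_smul, neg_neg]

theorem inclCl_mul_lorentz_mul_nul (v : Fin (d + 1 + 1) → ℝ)
    (c : ClE d) :
    ι (lorentzForm (d + 1)) v * (inclCl d c * nul d) =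
      inclCl d (ι _ (Fin.tail v) * c + v 0 • (involute c *
        ι _ (lastVec d))) * nul d := by
  rw [ι_lorentz, add_mul, smul_mul_assoc, ← mul_assoc (e 0), e_zero_mul_inclCl,
    mul_assoc (inclCl d (involute c)), e_zero_mul_nul, map_add, map_smul, map_mul, map_mul,
    add_mul, smul_mul_assoc]
  simp only [mul_assoc]
  abel

/-- In front of `e₀ - eₙ`, a product of vectors of `ℝ^{1,n}` may be replaced by a product of vectors
of `ℝⁿ`: this pushes `e₀` to the right, where `e₀ (e₀ - eₙ) = eₙ (e₀ - eₙ)`. -/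
theorem exists_lipschitz_mul_nul {g : (ClL d)ˣ}
    (hg : g ∈ lipschitzGroup (lorentzForm (d + 1))) :
    ∃ c ∈ lipschitzGroup (euclForm (d + 1)),
      (g : ClL d) * nul d = inclCl d c * nul d := by
  refine lipschitz_induction (p := fun g => ∃ c ∈ lipschitzGroup (euclForm (d + 1)),
      (g : ClL d) * nul d = inclCl d c * nul d)
    ⟨1, one_mem _, by simp⟩ ?_ hg
  rintro v hv y - ⟨c, hc, hy⟩
  obtain ⟨u, hu⟩ := lipschitzGroup.involute_act_ι_mem_range_ι hc (lastVec d)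
  have hu' : involute (c : ClE d) * ι _ (lastVec d) = ι _ u * (c : ClE d) := by
    rw [hu, Units.inv_mul_cancel_right]
  have key : ((vecUnit v hv * y : (ClL d)ˣ) :
      ClL d) * nul d =
      inclCl d (ι _ (Fin.tail v + v 0 • u) * (c : ClE d)) * nul d := by
    rw [Units.val_mul, mul_assoc, hy]
    change ι _ v * _ = _
    rw [inclCl_mul_lorentz_mul_nul, hu', map_add (ι _), add_mul (ι _ _), map_smul (ι _),
      smul_mul_assoc]
  have hne : Fin.tail v + v 0 • u ≠ 0 := by
    intro h0
    rw [h0, map_zero, zero_mul, map_zero, zero_mul] at key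
    exact nul_ne_zero ((Units.mul_right_eq_zero _).1 key)
  exact ⟨vecUnit _ (euclForm_neg hne).ne * c, mul_mem (vecUnit_mem _ _) hc, key⟩

/-- The spinor norm of a product of vectors of `ℝⁿ` is positive. -/
theorem exists_star_mul_self {n : ℕ} {c : (CliffordAlgebra (euclForm n))ˣ}
    (hc : c ∈ lipschitzGroup (euclForm n)) :
    ∃ r : ℝ, 0 < r ∧ star (c : CliffordAlgebra (euclForm n)) * c = algebraMap ℝ _ r ∧
      (c : CliffordAlgebra (euclForm n)) * star (c : CliffordAlgebra (euclForm n)) =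
        algebraMap ℝ _ r := by
  refine lipschitz_induction (p := fun c : (CliffordAlgebra (euclForm n))ˣ => ∃ r : ℝ, 0 < r ∧
    star (c : CliffordAlgebra (euclForm n)) * c = algebraMap ℝ _ r ∧
      (c : CliffordAlgebra (euclForm n)) * star (c : CliffordAlgebra (euclForm n)) =
        algebraMap ℝ _ r) ⟨1, one_pos, by simp⟩ ?_ hc
  rintro v hv y - ⟨r, hr, h1, h2⟩
  have hv0 : v ≠ 0 := by rintro rfl; simp at hv
  have h3 : star (ι (euclForm n) v) * ι _ v = algebraMap ℝ _ (-euclForm n v) := by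
    rw [star_ι, neg_mul, ι_sq_scalar, map_neg]
  have h4 : ι (euclForm n) v * star (ι _ v) = algebraMap ℝ _ (-euclForm n v) := by
    rw [star_ι, mul_neg, ι_sq_scalar, map_neg]
  refine ⟨-euclForm n v * r, mul_pos (neg_pos.2 (euclForm_neg hv0)) hr, ?_, ?_⟩
  · change star (ι _ v * (y : CliffordAlgebra (euclForm n))) *
      (ι _ v * (y : CliffordAlgebra (euclForm n))) = _
    rw [star_mul, mul_assoc, ← mul_assoc (star (ι _ v)), h3, ← mul_assoc, ← Algebra.commutes,
      mul_assoc, h1, map_mul]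
  · change (ι _ v * (y : CliffordAlgebra (euclForm n))) *
      star (ι _ v * (y : CliffordAlgebra (euclForm n))) = _
    rw [star_mul, mul_assoc, ← mul_assoc (y : CliffordAlgebra (euclForm n)), h2, ← mul_assoc,
      ← Algebra.commutes, mul_assoc, h4, ← map_mul, mul_comm]

theorem ι_mul_nul_add_swap (y : Fin (d + 1 + 1) → ℝ) :
    ι (lorentzForm (d + 1)) y * nul d + nul d * ι _ y =
      algebraMap ℝ _ (2 * (y 0 + y (Fin.last (d + 1)))) := by
  have hz : nul d = ι (lorentzForm (d + 1))
      (Fin.cons 1 (-lastVec d) : Fin (d + 1 + 1) → ℝ) := by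
    rw [ι_lorentz, Fin.tail_cons, Fin.cons_zero, one_smul, map_neg, map_neg, inclCl_lastVec,
      ← sub_eq_add_neg, nul]
  have hs : ∑ i : Fin (d + 1), (y i.succ + -lastVec d i) * (y i.succ + -lastVec d i) =
      ∑ i : Fin (d + 1), y i.succ * y i.succ - 2 * y (Fin.last (d + 1)) + 1 := by
    have : ∀ i, (y i.succ + -lastVec d i) * (y i.succ + -lastVec d i) =
        y i.succ * y i.succ - 2 * (if i = Fin.last d then y i.succ else 0) +
          if i = Fin.last d then 1 else 0 := by
      intro i
      rw [lastVec, Pi.single_apply]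
      split_ifs <;> ring
    simp only [this]
    rw [Finset.sum_add_distrib, Finset.sum_sub_distrib, ← Finset.mul_sum]
    simp
  rw [hz, ι_mul_ι_add_swap]
  congr 1
  rw [QuadraticMap.polar]
  simp only [lorentzForm_apply, Pi.add_apply, Fin.cons_zero, Fin.cons_succ, Pi.neg_apply, hs]
  have : ∑ i : Fin (d + 1), -lastVec d i * -lastVec d i = 1 := by
    simp [Pi.single_apply]
  rw [this]
  ring

/-- The elements of `G` that fix `e₀ - eₙ` under left multiplication lie in `N`. -/
theorem mem_N_of_mul_nul {ν : G (d + 1)}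
    (h : (ν : ClL d) * nul d = nul d) : ν ∈ N (d + 1) := by
  set x : ClL d := (ν : ClL d)
    with hx
  have hs : star x * x = 1 := spinGroup.star_mul_self_of_mem ν.2
  have hs' : x * star x = 1 := spinGroup.mul_star_self_of_mem ν.2
  have h' : nul d * star x = nul d := by
    have := congrArg star h
    rw [star_mul, star_nul, neg_mul] at this
    exact neg_injective this
  -- `u = ν e₀ ν⁻¹`, a vector
  obtain ⟨u, hu⟩ : ∃ u, ι (lorentzForm (d + 1)) u = x * e 0 * star x :=
    spinGroup.conjAct_smul_ι_mem_range_ι (x := spinGroup.toUnits ν) ν.2 (Pi.single 0 1)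
  have hd : ι (lorentzForm (d + 1)) u * nul d + nul d * ι _ u = 2 := by
    have h1 : ι (lorentzForm (d + 1)) u * nul d = x * (e 0 * nul d) * star x := by
      rw [hu]
      calc x * e 0 * star x * nul d = x * e 0 * (star x * (x * nul d)) := by
            rw [h]; noncomm_ring
        _ = x * e 0 * nul d := by rw [← mul_assoc (star x), hs, one_mul]
        _ = x * e 0 * (nul d * star x) := by rw [h']
        _ = _ := by noncomm_ring
    have h2 : nul d * ι (lorentzForm (d + 1)) u = x * (nul d * e 0) * star x := by
      rw [hu]
      calc nul d * (x * e 0 * star x) = nul d * star x * x * e 0 * star x := by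
            rw [h']; noncomm_ring
        _ = nul d * e 0 * star x := by rw [mul_assoc (nul d), hs, mul_one]
        _ = x * nul d * e 0 * star x := by rw [h]
        _ = _ := by noncomm_ring
    rw [h1, h2, ← add_mul, ← mul_add, add_comm (e 0 * nul d), nul_mul_e_zero_add, mul_two, add_mul,
      hs']
    exact one_add_one_eq_two
  have hue : x * e 0 = ι _ u * x := by rw [hu, mul_assoc, hs, mul_one]
  have hx2 : x * 2 = ι _ u * nul d + nul d * e 0 := by
    rw [← nul_mul_e_zero_add (d := d), mul_add, ← mul_assoc, ← mul_assoc, h, hue, mul_assoc, h]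
    abel
  -- `ν = 1 + ½ (u - e₀) (e₀ - eₙ)`, and `u - e₀` is orthogonal to `e₀ - eₙ`
  set y : Fin (d + 1 + 1) → ℝ := u - Pi.single 0 1 with hy
  have hy1 : ι (lorentzForm (d + 1)) y = ι _ u - e 0 := by rw [hy, map_sub, e]
  have hx3 : x * 2 = 2 + ι _ y * nul d := by
    rw [hx2, hy1, sub_mul, ← nul_mul_e_zero_add (d := d)]; abel
  have hlast : y (Fin.last (d + 1)) = -y 0 := by
    have h6 : ι (lorentzForm (d + 1)) y * nul d + nul d * ι _ y = algebraMap ℝ (ClL d) 0 := by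
      rw [map_zero, hy1, sub_mul, mul_sub,
        ← sub_eq_zero.2 (hd.trans (nul_mul_e_zero_add (d := d)).symm)]
      abel
    rw [ι_mul_nul_add_swap] at h6
    linarith [algebraMap_clifford_injective h6]
  refine ⟨(1 / 2 : ℝ) • (y - y 0 • (Pi.single 0 1 - Pi.single (Fin.last (d + 1)) 1)), ?_, ?_, ?_⟩
  · simp
  · simp [hlast]
  · change x = 1 + _ * nul d
    have h7 : ι (lorentzForm (d + 1)) ((1 / 2 : ℝ) •
        (y - y 0 • (Pi.single 0 1 - Pi.single (Fin.last (d + 1)) 1))) =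
        (1 / 2 : ℝ) • (ι _ y - y 0 • nul d) := by
      rw [map_smul, map_sub, map_smul, map_sub _ (Pi.single 0 1) (Pi.single _ 1), nul, e, e]
    rw [h7, smul_mul_assoc, sub_mul, smul_mul_assoc, show nul d * nul d = 0 from nil_sq, smul_zero,
      sub_zero]
    have h8 : ∀ z : ClL d, (1 / 2 : ℝ) • (z * 2) = z := fun z => by
      rw [mul_two, ← two_smul ℝ, smul_smul]; norm_num
    rw [← h8 x, hx3, smul_add, ← one_mul (2 : ClL d), h8]

theorem exists_iwasawa (g : G (d + 1)) :
    ∃ p : K (d + 1) × ℝ, ∃ ν ∈ N (d + 1), g = inclK (d + 1) p.1 * a p.2 * ν := by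
  obtain ⟨c, hc, hgc⟩ := exists_lipschitz_mul_nul
    (spinGroup.units_mem_lipschitzGroup (x := spinGroup.toUnits g) g.2)
  change (g : ClL d) * nul d = _ at hgc
  obtain ⟨r, hr, h1, h2⟩ := exists_star_mul_self hc
  have heven : (c : ClE d) ∈ evenOdd (euclForm (d + 1)) 0 := by
    refine (even_or_odd_of_lipschitz hc).resolve_right fun hodd => ?_
    -- an odd `c` contradicts `g (e₀ - eₙ) = c (e₀ - eₙ)` by applying the main involution
    have h3 := congrArg involute hgc
    have h4 : involute (nul d) = -nul d := by simp only [nul, e, map_sub, involute_ι]; abel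
    rw [map_mul, map_mul, ← map_involute, involute_eq_of_mem_odd hodd, spinGroup.involute_eq g.2,
      h4, map_neg, neg_mul_neg, mul_neg, hgc] at h3
    have h5 : (2 : ℝ) • (inclCl d c * nul d) = 0 := by
      rw [two_smul]
      nth_rewrite 1 [← h3]
      exact neg_add_cancel _
    rw [smul_eq_zero_iff_right two_ne_zero, ← hgc] at h5
    exact nul_ne_zero ((Units.mul_right_eq_zero (spinGroup.toUnits g)).1 h5)
  set q := Real.sqrt r with hq
  have hq0 : 0 < q := Real.sqrt_pos.2 hr
  have hqq : q * q = r := Real.mul_self_sqrt hr.le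
  have hq1 : q⁻¹ * q⁻¹ * r = 1 := by rw [← hqq]; field_simp
  have hk : q⁻¹ • (c : ClE d) ∈ spinGroup (euclForm (d + 1)) := by
    rw [spinGroup.mem_iff, pinGroup.mem_iff, Unitary.mem_iff]
    refine ⟨⟨?_, ?_, ?_⟩, Submodule.smul_mem _ _ heven⟩
    · have hv1 : euclForm (d + 1) (q⁻¹ • lastVec d) ≠ 0 := by
        rw [QuadraticMap.map_smul, euclForm_lastVec]; simp [hq0.ne']
      have hv2 : euclForm (d + 1) (-lastVec d) ≠ 0 := by
        rw [QuadraticMap.map_neg, euclForm_lastVec]; simp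
      refine ⟨vecUnit _ hv1 * vecUnit _ hv2 * c,
        mul_mem (mul_mem (vecUnit_mem _ _) (vecUnit_mem _ _)) hc, ?_⟩
      change ι _ (q⁻¹ • lastVec d) * ι _ (-lastVec d) * (c : ClE d) = _
      rw [map_smul, map_neg, smul_mul_assoc, mul_neg, ι_sq_scalar, euclForm_lastVec]
      simp
    · rw [CliffordAlgebra.star_smul, smul_mul_smul_comm, h1, Algebra.algebraMap_eq_smul_one,
        smul_smul, hq1, one_smul]
    · rw [CliffordAlgebra.star_smul, smul_mul_smul_comm, h2, Algebra.algebraMap_eq_smul_one,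
        smul_smul, hq1, one_smul]
  refine ⟨⟨⟨_, hk⟩, 2 * Real.log q⟩, (inclK (d + 1) ⟨_, hk⟩ * a (2 * Real.log q))⁻¹ * g,
    mem_N_of_mul_nul ?_, by group⟩
  have h5 : ((inclK (d + 1) ⟨_, hk⟩ * a (2 * Real.log q) : G (d + 1)) :
      ClL d) * nul d = g * nul d := by
    rw [Submonoid.coe_mul, mul_assoc, a_mul_nul, coe_inclK, hgc]
    simp only [map_smul]
    rw [smul_mul_smul_comm, mul_div_cancel_left₀ _ two_ne_zero, Real.exp_log hq0,
      inv_mul_cancel₀ hq0.ne', one_smul]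
  rw [Submonoid.coe_mul, mul_assoc, ← h5, ← mul_assoc, ← Submonoid.coe_mul, inv_mul_cancel,
    Submonoid.coe_one, one_mul]

theorem iwasawa_spec (g : G (d + 1)) :
    ∃ ν ∈ N (d + 1), g = inclK (d + 1) (kappa g) * a (H g) * ν :=
  Classical.epsilon_spec (exists_iwasawa g)

theorem N_mul_nul {ν : G (d + 1)} (hν : ν ∈ N (d + 1)) :
    (ν : ClL d) * nul d = nul d := by
  obtain ⟨x, -, -, hx⟩ := hν
  rw [hx, add_mul, one_mul, mul_assoc]
  rw [show (e 0 - e (Fin.last (d + 1))) * nul d = 0 from nil_sq, mul_zero, add_zero]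

/-- `g (e₀ - eₙ) = e^{H(g)/2} κ(g) (e₀ - eₙ)` in `Cl(1,n)`. -/
theorem coe_mul_nul (g : G (d + 1)) :
    (g : ClL d) * nul d =
      Real.exp (H g / 2) • (inclCl d (kappa g) * nul d) := by
  obtain ⟨ν, hν, h⟩ := iwasawa_spec g
  conv_lhs => rw [h]
  rw [Submonoid.coe_mul, Submonoid.coe_mul, mul_assoc, N_mul_nul hν, mul_assoc, a_mul_nul,
    mul_smul_comm, coe_inclK]

end Iwasawa

/-! ### Unitarity of the spin representation -/

section Unitary

variable {n : ℕ}

theorem inner_creation (j : Fin (n / 2)) (φ ψ : Spinor n) :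
    inner ℂ (creation j φ) ψ = inner ℂ φ (annihilation j ψ) := by
  simp only [PiLp.inner_apply, creation_apply, annihilation_apply]
  have h1 : ∀ I : Finset (Fin (n / 2)),
      inner ℂ (if j ∈ I then sgn j (I.erase j) * φ (I.erase j) else 0) (ψ I) =
        if j ∈ I then inner ℂ (sgn j (I.erase j) * φ (I.erase j)) (ψ I) else 0 := by
    intro I; split_ifs <;> simp
  have h2 : ∀ I : Finset (Fin (n / 2)),
      inner ℂ (φ I) (if j ∈ I then 0 else sgn j I * ψ (insert j I)) =
        if ¬ j ∈ I then inner ℂ (φ I) (sgn j I * ψ (insert j I)) else 0 := by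
    intro I; split_ifs <;> simp
  simp only [h1, h2]
  rw [← Finset.sum_filter, ← Finset.sum_filter]
  refine Finset.sum_nbij' (fun I => I.erase j) (fun I => insert j I) ?_ ?_ ?_ ?_ ?_
  · simp
  · simp
  · intro I hI
    simp only [Finset.mem_filter, Finset.mem_univ, true_and] at hI
    exact Finset.insert_erase hI
  · intro I hI
    simp only [Finset.mem_filter, Finset.mem_univ, true_and] at hI
    exact Finset.erase_insert hI
  · intro I hI
    simp only [Finset.mem_filter, Finset.mem_univ, true_and] at hI
    rw [Finset.insert_erase hI]
    simp only [RCLike.inner_apply, map_mul]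
    have : (starRingEnd ℂ) (sgn j (I.erase j)) = sgn j (I.erase j) := by simp [sgn]
    rw [this]
    ring

theorem inner_annihilation (j : Fin (n / 2)) (φ ψ : Spinor n) :
    inner ℂ (annihilation j φ) ψ = inner ℂ φ (creation j ψ) := by
  rw [← inner_conj_symm, ← inner_creation, inner_conj_symm]

theorem inner_parity (φ ψ : Spinor n) : inner ℂ (parity n φ) ψ = inner ℂ φ (parity n ψ) := by
  simp only [PiLp.inner_apply, parity_apply, RCLike.inner_apply, map_mul, map_pow, map_neg, map_one]
  exact Finset.sum_congr rfl fun I _ => by ring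

theorem inner_gam (j : Fin n) (φ ψ : Spinor n) :
    inner ℂ (gam j φ) ψ = -inner ℂ φ (gam j ψ) := by
  unfold gam
  split_ifs
  · simp only [LinearMap.sub_apply, inner_sub_left, inner_sub_right, inner_creation,
      inner_annihilation]
    ring
  · simp only [LinearMap.smul_apply, LinearMap.add_apply, inner_smul_left, inner_smul_right,
      inner_add_left, inner_add_right, inner_creation, inner_annihilation, map_neg, Complex.conj_I]
    ring
  · simp only [LinearMap.smul_apply, inner_smul_left, inner_smul_right, inner_parity,
      Complex.conj_I, neg_mul]

/-- Vectors act on spinors by skew-adjoint operators. -/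
theorem inner_cliffordMul (x : Fin n → ℝ) (φ ψ : Spinor n) :
    inner ℂ (cliffordMul n x φ) ψ = -inner ℂ φ (cliffordMul n x ψ) := by
  simp only [cliffordMul, LinearMap.coe_mk, AddHom.coe_mk, LinearMap.sum_apply, sum_inner,
    inner_sum, LinearMap.smul_apply, inner_smul_left, inner_smul_right, inner_gam,
    Complex.conj_ofReal, mul_neg, Finset.sum_neg_distrib]

theorem cliffordRep_ι (x : Fin n → ℝ) :
    cliffordRep n (ι _ x) = cliffordMul n x := by
  rw [cliffordRep, lift_ι_apply]

theorem inner_cliffordRep (x : CliffordAlgebra (euclForm n)) (φ ψ : Spinor n) :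
    inner ℂ (cliffordRep n x φ) ψ = inner ℂ φ (cliffordRep n (star x) ψ) := by
  induction x using CliffordAlgebra.induction generalizing φ ψ with
  | algebraMap r =>
    rw [star_algebraMap, AlgHom.commutes, Algebra.algebraMap_eq_smul_one, LinearMap.smul_apply,
      LinearMap.smul_apply, ← Complex.coe_smul, ← Complex.coe_smul, inner_smul_left,
      inner_smul_right, Complex.conj_ofReal]
    rfl
  | ι v =>
    rw [star_ι, map_neg, LinearMap.neg_apply, inner_neg_right, cliffordRep_ι, inner_cliffordMul]
  | mul a b ha hb =>
    rw [star_mul, map_mul, map_mul, Module.End.mul_apply, Module.End.mul_apply, ha, hb]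
  | add a b ha hb =>
    rw [star_add, map_add, map_add, LinearMap.add_apply, LinearMap.add_apply, inner_add_left,
      inner_add_right, ha, hb]

theorem spinRep_apply (k : K n) (ψ : Spinor n) :
    spinRep n k ψ = cliffordRep n (k : CliffordAlgebra (euclForm n)) ψ := rfl

theorem inner_spinRep (k : K n) (φ ψ : Spinor n) :
    inner ℂ (spinRep n k φ) (spinRep n k ψ) = inner ℂ φ ψ := by
  rw [spinRep_apply, spinRep_apply, inner_cliffordRep, ← Module.End.mul_apply, ← map_mul,
    spinGroup.star_mul_self_of_mem k.2, map_one, Module.End.one_apply]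

theorem spinRep_apply_inv (k : K n) (ψ : Spinor n) : spinRep n k (spinRep n k⁻¹ ψ) = ψ := by
  rw [← Module.End.mul_apply, ← map_mul, mul_inv_cancel, map_one, Module.End.one_apply]

theorem norm_spinRep (k : K n) (ψ : Spinor n) : ‖spinRep n k ψ‖ = ‖ψ‖ := by
  rw [@norm_eq_sqrt_re_inner ℂ, inner_spinRep, ← norm_eq_sqrt_re_inner]

theorem norm_cliffordMul_sq (u : Fin n → ℝ) (φ : Spinor n) :
    ‖cliffordMul n u φ‖ ^ 2 = (u ⬝ᵥ u) * ‖φ‖ ^ 2 := by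
  have h : inner ℂ (cliffordMul n u φ) (cliffordMul n u φ) =
      ((u ⬝ᵥ u : ℝ) : ℂ) * inner ℂ φ φ := by
    rw [inner_cliffordMul, ← Module.End.mul_apply, cliffordMul_sq, Algebra.algebraMap_eq_smul_one,
      LinearMap.smul_apply, Module.End.one_apply, ← Complex.coe_smul, inner_smul_right,
      euclForm_apply, dotProduct, Complex.ofReal_neg, neg_mul, neg_neg]
  have h2 := congrArg Complex.re h
  rw [Complex.re_ofReal_mul] at h2
  rw [← @inner_self_eq_norm_sq ℂ, ← @inner_self_eq_norm_sq ℂ]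
  exact h2

theorem re_inner_cliffordMul (u v : Fin n → ℝ) (φ : Spinor n) :
    (inner ℂ (cliffordMul n u φ) (cliffordMul n v φ)).re = (u ⬝ᵥ v) * ‖φ‖ ^ 2 := by
  have h := @norm_add_sq ℂ _ _ _ _ (cliffordMul n u φ) (cliffordMul n v φ)
  rw [← LinearMap.add_apply, ← map_add, norm_cliffordMul_sq, norm_cliffordMul_sq,
    norm_cliffordMul_sq, add_dotProduct, dotProduct_add, dotProduct_add, dotProduct_comm v u] at h
  simp only [RCLike.re_to_complex] at h
  linarith

/-- The vacuum, a unit spinor. -/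
def vacuum (n : ℕ) : Spinor n := EuclideanSpace.single ∅ 1

theorem norm_vacuum : ‖vacuum n‖ = 1 := by simp [vacuum]

end Unitary

/-! ### The spin representation of `Cl(1,n)` -/

section Lorentz

variable {n d : ℕ}

/-- Clifford multiplication by vectors `(x₀, x)` of `ℝ^{1,n}` on `𝕊ₙ ⊕ 𝕊ₙ`: the block matrix with
rows `(x, x₀)` and `(x₀, -x)`. -/
def lorentzMul (n : ℕ) : (Fin (n + 1) → ℝ) →ₗ[ℝ] Module.End ℂ (Spinor n × Spinor n) where
  toFun v := (cliffordMul n (Fin.tail v)).prodMap (-cliffordMul n (Fin.tail v)) +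
    (v 0 : ℂ) • (LinearMap.snd ℂ (Spinor n) (Spinor n)).prod (LinearMap.fst ℂ _ _)
  map_add' v w := by
    have : Fin.tail (v + w) = (Fin.tail v + Fin.tail w : Fin n → ℝ) := rfl
    refine LinearMap.ext fun p => Prod.ext ?_ ?_ <;> simp [this, add_smul] <;> abel
  map_smul' c v := by
    have : Fin.tail (c • v) = (c • Fin.tail v : Fin n → ℝ) := rfl
    refine LinearMap.ext fun p => Prod.ext ?_ ?_ <;> simp [this, mul_smul]

theorem lorentzMul_apply (v : Fin (n + 1) → ℝ) (p : Spinor n × Spinor n) :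
    lorentzMul n v p = (cliffordMul n (Fin.tail v) p.1 + (v 0 : ℂ) • p.2,
      -cliffordMul n (Fin.tail v) p.2 + (v 0 : ℂ) • p.1) := by
  simp [lorentzMul]

theorem lorentzMul_sq (v : Fin (n + 1) → ℝ) :
    lorentzMul n v * lorentzMul n v = algebraMap ℝ _ (lorentzForm n v) := by
  have h : ∀ φ, cliffordMul n (Fin.tail v) (cliffordMul n (Fin.tail v) φ) =
      (euclForm n (Fin.tail v) : ℂ) • φ := fun φ => by
    rw [← Module.End.mul_apply, cliffordMul_sq, Algebra.algebraMap_eq_smul_one,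
      LinearMap.smul_apply, Module.End.one_apply, ← Complex.coe_smul]
  have hQ : lorentzForm n v = v 0 * v 0 + euclForm n (Fin.tail v) := by
    rw [lorentzForm_apply, euclForm_apply, sub_eq_add_neg]; rfl
  refine LinearMap.ext fun p => ?_
  rw [Module.End.mul_apply, lorentzMul_apply, lorentzMul_apply, Algebra.algebraMap_eq_smul_one,
    LinearMap.smul_apply, Module.End.one_apply, ← Complex.coe_smul, hQ]
  refine Prod.ext ?_ ?_
  · simp only [map_add, map_smul, h, Prod.smul_fst, smul_add, smul_neg, smul_smul]
    push_cast
    rw [add_smul]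
    abel
  · simp only [map_add, map_smul, map_neg, h, Prod.smul_snd, smul_add, smul_smul]
    push_cast
    rw [add_smul]
    abel

/-- The action of `Cl(1,n)` on `𝕊ₙ ⊕ 𝕊ₙ`. -/
def lorentzRep (n : ℕ) :
    CliffordAlgebra (lorentzForm n) →ₐ[ℝ] Module.End ℂ (Spinor n × Spinor n) :=
  CliffordAlgebra.lift (lorentzForm n) ⟨lorentzMul n, lorentzMul_sq⟩

theorem lorentzRep_ι (v : Fin (n + 1) → ℝ) : lorentzRep n (ι _ v) = lorentzMul n v := by
  rw [lorentzRep, lift_ι_apply]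

theorem lorentzRep_map (x : CliffordAlgebra (euclForm n)) (p : Spinor n × Spinor n) :
    lorentzRep n (CliffordAlgebra.map (inclLorentz n) x) p =
      (cliffordRep n x p.1, cliffordRep n (involute x) p.2) := by
  induction x using CliffordAlgebra.induction generalizing p with
  | algebraMap r =>
    rw [AlgHom.commutes, AlgHom.commutes, AlgHom.commutes, AlgHom.commutes, AlgHom.commutes]
    rfl
  | ι v =>
    have h : inclLorentz n v = (Fin.cons 0 v : Fin (n + 1) → ℝ) := rfl
    rw [map_apply_ι, lorentzRep_ι, lorentzMul_apply, h]
    simp [cliffordRep_ι]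
  | mul a b ha hb => simp only [map_mul, Module.End.mul_apply, ha, hb]
  | add a b ha hb => simp only [map_add, LinearMap.add_apply, ha, hb, Prod.mk_add_mk]

theorem lorentzRep_e_zero (p : Spinor n × Spinor n) : lorentzRep n (e 0) p = (p.2, p.1) := by
  have h : (Fin.tail (Pi.single 0 1 : Fin (n + 1) → ℝ)) = 0 := by
    ext i; simp [Fin.tail]
  rw [e, lorentzRep_ι, lorentzMul_apply, h]
  simp

theorem lorentzRep_e_last (p : Spinor (d + 1) × Spinor (d + 1)) :
    lorentzRep (d + 1) (e (Fin.last (d + 1))) p =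
      (cliffordMul (d + 1) (lastVec d) p.1, -cliffordMul (d + 1) (lastVec d) p.2) := by
  rw [← inclCl_lastVec, lorentzRep_map, involute_ι, map_neg, cliffordRep_ι, LinearMap.neg_apply]

theorem lorentzRep_inclK (k : K n) (p : Spinor n × Spinor n) :
    lorentzRep n (inclK n k : G n) p = (spinRep n k p.1, spinRep n k p.2) := by
  rw [coe_inclK, lorentzRep_map, spinGroup.involute_eq k.2]; rfl

/-- The spinor `(ψ, eₙψ)`, the image of `(0, ψ)` under `e₀ - eₙ`. -/
def nulSpinor (d : ℕ) : Spinor (d + 1) →ₗ[ℂ] Spinor (d + 1) × Spinor (d + 1) :=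
  LinearMap.prod LinearMap.id (cliffordMul (d + 1) (lastVec d))

theorem nulSpinor_apply (ψ : Spinor (d + 1)) :
    nulSpinor d ψ = (ψ, cliffordMul (d + 1) (lastVec d) ψ) := rfl

theorem lorentzRep_nul (ψ : Spinor (d + 1)) :
    lorentzRep (d + 1) (nul d) (0, ψ) = nulSpinor d ψ := by
  rw [nul, map_sub, LinearMap.sub_apply, lorentzRep_e_zero, lorentzRep_e_last, nulSpinor_apply]
  simp

/-- In the representation of `Cl(1,n)`, the Iwasawa components `κ(g)` and `H(g)` are read off from
the action of `g` on the image of `e₀ - eₙ`. -/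
theorem lorentzRep_nulSpinor (g : G (d + 1)) (ψ : Spinor (d + 1)) :
    lorentzRep (d + 1) (g : ClL d) (nulSpinor d ψ) =
      Real.exp (H g / 2) • (spinRep (d + 1) (kappa g) ψ,
        spinRep (d + 1) (kappa g) (cliffordMul (d + 1) (lastVec d) ψ)) := by
  rw [← lorentzRep_nul, ← Module.End.mul_apply, ← map_mul, coe_mul_nul, map_smul, map_mul,
    LinearMap.smul_apply, Module.End.mul_apply, lorentzRep_nul]
  exact congrArg _ (lorentzRep_inclK (kappa g) (nulSpinor d ψ))

theorem norm_lorentzRep_nulSpinor (g : G (d + 1)) (ψ : Spinor (d + 1)) :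
    ‖(lorentzRep (d + 1) (g : ClL d) (nulSpinor d ψ)).1‖ = Real.exp (H g / 2) * ‖ψ‖ := by
  rw [lorentzRep_nulSpinor, Prod.smul_fst, norm_smul, norm_spinRep, Real.norm_eq_abs,
    Real.abs_exp]

end Lorentz

/-! ### The rotation of `eₙ` by an element of `K` -/

section Axis

variable {d : ℕ}

theorem exists_axis (k : K (d + 1)) :
    ∃ u, ι (euclForm (d + 1)) u = (k : ClE d) * ι _ (lastVec d) * star (k : ClE d) :=
  spinGroup.conjAct_smul_ι_mem_range_ι (x := spinGroup.toUnits k) k.2 (lastVec d)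

/-- The vector `k eₙ k⁻¹` of the unit sphere. -/
def axis (k : K (d + 1)) : Fin (d + 1) → ℝ := (exists_axis k).choose

theorem ι_axis (k : K (d + 1)) :
    ι (euclForm (d + 1)) (axis k) = (k : ClE d) * ι _ (lastVec d) * star (k : ClE d) :=
  (exists_axis k).choose_spec

theorem axis_dot_self (k : K (d + 1)) : axis k ⬝ᵥ axis k = 1 := by
  have h : ι (euclForm (d + 1)) (axis k) * ι _ (axis k) = algebraMap ℝ (ClE d) (-1) := by
    rw [ι_axis]
    calc (k : ClE d) * ι _ (lastVec d) * star (k : ClE d) *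
          ((k : ClE d) * ι _ (lastVec d) * star (k : ClE d))
        = (k : ClE d) * ι _ (lastVec d) * (star (k : ClE d) * (k : ClE d)) * ι _ (lastVec d) *
          star (k : ClE d) := by noncomm_ring
      _ = (k : ClE d) * (ι _ (lastVec d) * ι _ (lastVec d)) * star (k : ClE d) := by
          rw [spinGroup.star_mul_self_of_mem k.2]; noncomm_ring
      _ = _ := by
          rw [ι_sq_scalar, euclForm_lastVec, ← Algebra.commutes, mul_assoc,
            spinGroup.mul_star_self_of_mem k.2, mul_one]
  rw [ι_sq_scalar] at h
  have h2 := algebraMap_clifford_injective h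
  rw [euclForm_apply] at h2
  exact neg_injective h2

theorem spinRep_cliffordMul (k : K (d + 1)) (φ : Spinor (d + 1)) :
    spinRep (d + 1) k (cliffordMul (d + 1) (lastVec d) φ) =
      cliffordMul (d + 1) (axis k) (spinRep (d + 1) k φ) := by
  rw [← cliffordRep_ι, ← cliffordRep_ι, ι_axis, spinRep_apply, spinRep_apply,
    ← Module.End.mul_apply, ← Module.End.mul_apply, ← map_mul, ← map_mul, mul_assoc _ (star _),
    spinGroup.star_mul_self_of_mem k.2, mul_one]

theorem axis_inv_mul (k h : K (d + 1)) :
    axis (k⁻¹ * h) (Fin.last d) = axis k ⬝ᵥ axis h := by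
  have h1 := re_inner_cliffordMul (axis k) (axis h) (spinRep (d + 1) k (vacuum (d + 1)))
  have h2 : cliffordMul (d + 1) (axis h) (spinRep (d + 1) k (vacuum (d + 1))) =
      spinRep (d + 1) k (cliffordMul (d + 1) (axis (k⁻¹ * h)) (vacuum (d + 1))) := by
    have hk : spinRep (d + 1) k (vacuum (d + 1)) =
        spinRep (d + 1) h (spinRep (d + 1) (k⁻¹ * h)⁻¹ (vacuum (d + 1))) := by
      rw [← Module.End.mul_apply, ← map_mul]; congr 2; group
    have hv : vacuum (d + 1) = spinRep (d + 1) (k⁻¹ * h)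
        (spinRep (d + 1) (k⁻¹ * h)⁻¹ (vacuum (d + 1))) := (spinRep_apply_inv _ _).symm
    rw [hk, ← spinRep_cliffordMul]
    conv_rhs => rw [hv]
    rw [← spinRep_cliffordMul, ← Module.End.mul_apply (spinRep (d + 1) k), ← map_mul,
      mul_inv_cancel_left]
  rw [h2, ← spinRep_cliffordMul, inner_spinRep, re_inner_cliffordMul, norm_spinRep,
    norm_vacuum] at h1
  simpa using h1

/-- The Iwasawa projection of `a_{-t} k`. -/
theorem exp_H_a_mul (t : ℝ) (k : K (d + 1)) :
    Real.exp (H ((a t)⁻¹ * inclK (d + 1) k)) =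
      Real.cosh t - Real.sinh t * axis k (Fin.last d) := by
  set c := Real.cosh (t / 2) with hc
  set s := Real.sinh (t / 2) with hs
  set φ := spinRep (d + 1) k (vacuum (d + 1)) with hφ
  have hφ1 : ‖φ‖ = 1 := by rw [hφ, norm_spinRep, norm_vacuum]
  have h1 := norm_lorentzRep_nulSpinor ((a t)⁻¹ * inclK (d + 1) k) (vacuum (d + 1))
  have h2 : (lorentzRep (d + 1) (((a t)⁻¹ * inclK (d + 1) k : G (d + 1)) : ClL d)
      (nulSpinor d (vacuum (d + 1)))).1 =
      (c : ℂ) • φ + (s : ℂ) • cliffordMul (d + 1) (lastVec d) (cliffordMul (d + 1) (axis k) φ) := by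
    rw [Submonoid.coe_mul, map_mul, Module.End.mul_apply, lorentzRep_inclK, nulSpinor_apply,
      ← a_neg, coe_a, neg_div, Real.cosh_neg, Real.sinh_neg, map_add, map_smul, map_mul,
      AlgHom.commutes, Algebra.algebraMap_eq_smul_one, LinearMap.add_apply, LinearMap.smul_apply,
      LinearMap.smul_apply, Module.End.mul_apply, lorentzRep_e_last, lorentzRep_e_zero,
      spinRep_cliffordMul, Complex.coe_smul, Complex.coe_smul]
    simp [← hφ, ← hs, ← hc]
  rw [h2, norm_vacuum, mul_one] at h1
  have h3 : Real.exp (H ((a t)⁻¹ * inclK (d + 1) k)) =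
      Real.exp (H ((a t)⁻¹ * inclK (d + 1) k) / 2) ^ 2 := by
    rw [← Real.exp_nat_mul]; congr 1; push_cast; ring
  have h4 : ‖cliffordMul (d + 1) (lastVec d) (cliffordMul (d + 1) (axis k) φ)‖ ^ 2 = 1 := by
    rw [norm_cliffordMul_sq, norm_cliffordMul_sq, axis_dot_self, hφ1]
    simp
  have h5 : (inner ℂ φ (cliffordMul (d + 1) (lastVec d) (cliffordMul (d + 1) (axis k) φ))).re =
      -axis k (Fin.last d) := by
    have := re_inner_cliffordMul (lastVec d) (axis k) φ
    rw [inner_cliffordMul, Complex.neg_re, hφ1] at this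
    rw [← neg_eq_iff_eq_neg, this]
    simp
  rw [h3, ← h1, @norm_add_sq ℂ, norm_smul, norm_smul, mul_pow, mul_pow, h4, hφ1, inner_smul_left,
    inner_smul_right, Complex.conj_ofReal]
  simp only [RCLike.re_to_complex, Complex.re_ofReal_mul, h5, Complex.norm_real, Real.norm_eq_abs,
    sq_abs]
  have e1 : Real.cosh t = c ^ 2 + s ^ 2 := by
    rw [hc, hs, ← Real.cosh_two_mul]; congr 1; ring
  have e2 : Real.sinh t = 2 * s * c := by
    rw [hc, hs, ← Real.sinh_two_mul]; congr 1; ring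
  rw [e1, e2]
  ring

theorem ι_eucl_injective {n : ℕ} : Function.Injective (ι (euclForm n)) := by
  refine (injective_iff_map_eq_zero _).2 fun v hv => by_contra fun hv0 => ?_
  have h := ι_sq_scalar (euclForm n) v
  rw [hv, mul_zero, ← map_zero (algebraMap ℝ _)] at h
  exact (euclForm_neg hv0).ne (algebraMap_clifford_injective h).symm

theorem polar_euclForm {n : ℕ} (u v : Fin n → ℝ) :
    QuadraticMap.polar (euclForm n) u v = -(2 * (u ⬝ᵥ v)) := by
  have h : ∀ x, euclForm n x = -(x ⬝ᵥ x) := euclForm_apply n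
  rw [QuadraticMap.polar, h, h, h, add_dotProduct, dotProduct_add, dotProduct_add,
    dotProduct_comm v u]
  ring

/-- Every point of the closed upper half-sphere is `k eₙ k⁻¹` for a product `k` of two unit
vectors. -/
theorem exists_axis_eq {y : Fin (d + 1) → ℝ} (hy : y ⬝ᵥ y = 1) (hy0 : 0 ≤ y (Fin.last d)) :
    ∃ k : K (d + 1), axis k = y := by
  set r := Real.sqrt (2 * (1 + y (Fin.last d))) with hr
  have hr0 : 0 < r := Real.sqrt_pos.2 (by linarith)
  have hrr : r * r = 2 * (1 + y (Fin.last d)) := Real.mul_self_sqrt (by linarith)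
  -- the reflection in `v` maps `-eₙ` to `y`
  set v : Fin (d + 1) → ℝ := r⁻¹ • (y + lastVec d) with hv
  have hvl : 2 * v (Fin.last d) = r := by
    simp only [hv, Pi.smul_apply, Pi.add_apply, Pi.single_eq_same, smul_eq_mul]
    field_simp
    linarith
  have hvy : y = r • v - lastVec d := by
    rw [hv, smul_smul, mul_inv_cancel₀ hr0.ne', one_smul, add_sub_cancel_right]
  have hv1 : euclForm (d + 1) v = -1 := by
    have h1 : r * r * (v ⬝ᵥ v) = r * r := by
      have : (r • v) ⬝ᵥ (r • v) = r * r * (v ⬝ᵥ v) := by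
        rw [smul_dotProduct, dotProduct_smul, smul_eq_mul, smul_eq_mul, mul_assoc]
      rw [← this, show r • v = y + lastVec d by rw [hvy]; abel, hrr, add_dotProduct,
        dotProduct_add, dotProduct_add, hy]
      simp
      ring
    rw [euclForm_apply]
    exact congrArg Neg.neg (mul_left_cancel₀ (mul_pos hr0 hr0).ne' (h1.trans (mul_one _).symm))
  refine ⟨⟨_, ι_mul_ι_mem_spinGroup v (lastVec d) (-1) (by norm_num) hv1 euclForm_lastVec⟩, ?_⟩
  refine ι_eucl_injective ?_
  have hvv : ι (euclForm (d + 1)) v * ι _ v = -1 := by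
    rw [ι_sq_scalar, hv1, map_neg, map_one]
  have hee : ι (euclForm (d + 1)) (lastVec d) * ι _ (lastVec d) = -1 := by
    rw [ι_sq_scalar, euclForm_lastVec, map_neg, map_one]
  have hve : ι (euclForm (d + 1)) v * ι _ (lastVec d) =
      -(r • 1) - ι _ (lastVec d) * ι _ v := by
    rw [eq_sub_iff_add_eq, ι_mul_ι_add_swap, polar_euclForm, dotProduct_single, mul_one, hvl,
      map_neg, Algebra.algebraMap_eq_smul_one]
  rw [ι_axis, star_mul, star_ι, star_ι, neg_mul_neg (ι _ (lastVec d))]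
  conv_rhs => rw [hvy, map_sub, map_smul]
  calc ι (euclForm (d + 1)) v * ι _ (lastVec d) * ι _ (lastVec d) *
        (ι _ (lastVec d) * ι _ v)
      = ι _ v * (ι _ (lastVec d) * ι _ (lastVec d)) * ι _ (lastVec d) * ι _ v := by
        noncomm_ring
    _ = -(ι _ v * ι _ (lastVec d)) * ι _ v := by rw [hee]; noncomm_ring
    _ = r • ι _ v + ι _ (lastVec d) * (ι _ v * ι _ v) := by
        rw [hve, neg_sub, sub_neg_eq_add, add_mul, smul_mul_assoc, one_mul, mul_assoc]; abel
    _ = _ := by rw [hvv, mul_neg, mul_one, sub_eq_add_neg]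

end Axis

/-! ### Continuity -/

section Continuity

variable {n d : ℕ}

theorem continuous_linear_coe {E : Type*} [NormedAddCommGroup E] [NormedSpace ℝ E]
    (T : CliffordAlgebra (euclForm n) →ₗ[ℝ] E) : Continuous fun k : K n => T k := by
  let _ : TopologicalSpace (CliffordAlgebra (euclForm n)) := moduleTopology ℝ _
  have _ : IsModuleTopology ℝ (CliffordAlgebra (euclForm n)) := ⟨rfl⟩
  exact (IsModuleTopology.continuous_of_linearMap T).comp continuous_induced_dom

theorem continuous_mul_left_K (k : K n) : Continuous fun h : K n => k * h := by
  let _ : TopologicalSpace (CliffordAlgebra (euclForm n)) := moduleTopology ℝ _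
  have _ : IsModuleTopology ℝ (CliffordAlgebra (euclForm n)) := ⟨rfl⟩
  have _ := IsModuleTopology.toContinuousAdd ℝ (CliffordAlgebra (euclForm n))
  refine continuous_induced_rng.2 ?_
  exact (IsModuleTopology.continuous_of_linearMap (LinearMap.mulLeft ℝ
    (k : CliffordAlgebra (euclForm n)))).comp continuous_induced_dom

theorem continuous_spinRep_inv (ψ : Spinor n) : Continuous fun k : K n => spinRep n k⁻¹ ψ := by
  have h : ∀ k : K n, spinRep n k⁻¹ ψ =
      ((LinearMap.applyₗ ψ).restrictScalars ℝ ∘ₗ (cliffordRep n).toLinearMap ∘ₗ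
        reverse ∘ₗ (involute (Q := euclForm n)).toLinearMap) k := fun k => by
    rw [← spinGroup.star_eq_inv, spinRep_apply, spinGroup.coe_star, star_def]; rfl
  simp only [h]
  exact continuous_linear_coe _

theorem axis_apply_eq (k : K (d + 1)) (i : Fin (d + 1)) :
    axis k i = (inner ℂ
      (spinRep (d + 1) k⁻¹ (cliffordMul (d + 1) (Pi.single i 1) (vacuum (d + 1))))
      (cliffordMul (d + 1) (lastVec d) (spinRep (d + 1) k⁻¹ (vacuum (d + 1))))).re := by
  rw [← inner_spinRep k, spinRep_cliffordMul, spinRep_apply_inv, spinRep_apply_inv,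
    re_inner_cliffordMul, norm_vacuum]
  simp

theorem continuous_axis : Continuous (axis : K (d + 1) → Fin (d + 1) → ℝ) := by
  refine continuous_pi fun i => ?_
  simp only [axis_apply_eq]
  refine Complex.continuous_re.comp ((continuous_spinRep_inv _).inner ?_)
  exact (LinearMap.continuous_of_finiteDimensional (cliffordMul (d + 1) (lastVec d))).comp
    (continuous_spinRep_inv _)

/-- The action of `Cl(1,n)` by bounded operators. -/
def lorentzOp (n : ℕ) : CliffordAlgebra (lorentzForm n) →ₗ[ℝ]
    (Spinor n × Spinor n →L[ℂ] Spinor n × Spinor n) :=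
  (LinearMap.toContinuousLinearMap (𝕜 := ℂ) (E := Spinor n × Spinor n)
    (F' := Spinor n × Spinor n)).toLinearMap.restrictScalars ℝ ∘ₗ (lorentzRep n).toLinearMap

theorem lorentzOp_apply (x : CliffordAlgebra (lorentzForm n)) (p : Spinor n × Spinor n) :
    lorentzOp n x p = lorentzRep n x p := rfl

theorem lorentzOp_mul (x y : CliffordAlgebra (lorentzForm n)) :
    lorentzOp n (x * y) = lorentzOp n x * lorentzOp n y := by
  refine ContinuousLinearMap.ext fun p => ?_
  change lorentzRep n (x * y) p = lorentzRep n x (lorentzRep n y p)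
  rw [map_mul, Module.End.mul_apply]

theorem continuous_lorentzOp_inclK :
    Continuous fun k : K n => lorentzOp n (inclK n k : G n) :=
  continuous_linear_coe (lorentzOp n ∘ₗ (CliffordAlgebra.map (inclLorentz n)).toLinearMap)

theorem continuous_lorentzOp_inclK_inv :
    Continuous fun k : K n => lorentzOp n ((inclK n k)⁻¹ : G n) := by
  have h : ∀ k : K n, lorentzOp n ((inclK n k)⁻¹ : G n) =
      (lorentzOp n ∘ₗ (CliffordAlgebra.map (inclLorentz n)).toLinearMap ∘ₗ
        reverse ∘ₗ (involute (Q := euclForm n)).toLinearMap) k := fun k => by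
    rw [← map_inv, ← spinGroup.star_eq_inv, coe_inclK, spinGroup.coe_star, star_def]; rfl
  simp only [h]
  exact continuous_linear_coe _

end Continuity

/-! ### The kernel estimate -/

section Kernel

variable {d : ℕ}

/-- The zonal kernel `(cosh t - x sinh t)^{-s}` as a function of the cosine `x`. -/
def zonal (s t x : ℝ) : ℝ≥0∞ := ENNReal.ofReal ((Real.cosh t - Real.sinh t * x) ^ (-s))

theorem measurable_zonal (s t : ℝ) : Measurable (zonal s t) := by
  unfold zonal
  fun_prop

theorem zonal_axis (s t : ℝ) (k h : K (d + 1)) :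
    zonal s t (axis k ⬝ᵥ axis h) =
      ENNReal.ofReal (Real.exp (-s * H ((inclK (d + 1) k * a t)⁻¹ * inclK (d + 1) h))) := by
  have : (inclK (d + 1) k * a t)⁻¹ * inclK (d + 1) h = (a t)⁻¹ * inclK (d + 1) (k⁻¹ * h) := by
    rw [map_mul, map_inv]; group
  rw [this, zonal, ← axis_inv_mul, ← exp_H_a_mul, ← Real.exp_mul, mul_comm]

theorem measurable_axis : Measurable (axis : K (d + 1) → Fin (d + 1) → ℝ) :=
  continuous_axis.measurable

theorem measurable_dot : Measurable fun p : (Fin (d + 1) → ℝ) × (Fin (d + 1) → ℝ) =>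
    p.1 ⬝ᵥ p.2 := by
  unfold dotProduct
  fun_prop

theorem measurable_zonal_axis (s t : ℝ) :
    Measurable fun p : K (d + 1) × K (d + 1) => zonal s t (axis p.1 ⬝ᵥ axis p.2) :=
  (measurable_zonal s t).comp (measurable_dot.comp
    ((measurable_axis.comp measurable_fst).prodMk (measurable_axis.comp measurable_snd)))

/-- The mass of the kernel on the orbit of `eₙ` does not depend on the base point. -/
theorem lintegral_zonal_axis (μ : Measure (K (d + 1))) [μ.IsMulLeftInvariant] (s t : ℝ)
    (k : K (d + 1)) :
    ∫⁻ h, zonal s t (axis k ⬝ᵥ axis h) ∂μ = ∫⁻ h, zonal s t (axis h (Fin.last d)) ∂μ := by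
  have hm : Measurable fun h : K (d + 1) => zonal s t (axis h (Fin.last d)) :=
    (measurable_zonal s t).comp ((measurable_pi_apply _).comp measurable_axis)
  simp only [← axis_inv_mul]
  conv_rhs => rw [← Measure.IsMulLeftInvariant.map_mul_left_eq_self (μ := μ) k⁻¹,
    lintegral_map hm (continuous_mul_left_K k⁻¹).measurable]

/-- The point of the upper half-sphere over `z`. -/
def hemisphere (z : Fin d → ℝ) : Fin (d + 1) → ℝ := Fin.snoc z (Real.sqrt (1 - z ⬝ᵥ z))

theorem hemisphere_dot_self {z : Fin d → ℝ} (hz : z ⬝ᵥ z ≤ 1) :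
    hemisphere z ⬝ᵥ hemisphere z = 1 := by
  rw [dotProduct, Fin.sum_univ_castSucc]
  simp only [hemisphere, Fin.snoc_castSucc, Fin.snoc_last]
  rw [Real.mul_self_sqrt (by linarith)]
  change z ⬝ᵥ z + _ = 1
  ring

theorem measurable_hemisphere : Measurable (hemisphere : (Fin d → ℝ) → _) := by
  refine measurable_pi_iff.2 fun i => ?_
  refine Fin.lastCases ?_ (fun j => ?_) i
  · simp only [hemisphere, Fin.snoc_last, dotProduct]; fun_prop
  · simp only [hemisphere, Fin.snoc_castSucc]; fun_prop

/-- In a small ball of `ℝⁿ⁻¹`, the points are projections of points of the sphere. -/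
theorem dot_self_le_one {z : Fin d → ℝ} (hz : z ∈ Metric.ball (0 : Fin d → ℝ) (1 / (d + 1))) :
    z ⬝ᵥ z ≤ 1 := by
  rw [mem_ball_zero_iff] at hz
  have hd : (0 : ℝ) < d + 1 := by positivity
  have h1 : ∀ i, z i * z i ≤ 1 / (d + 1) := fun i => by
    have h2 : |z i| ≤ 1 / (d + 1) := (norm_le_pi_norm z i).trans hz.le
    have h3 : (1 : ℝ) / (d + 1) ≤ 1 := by rw [div_le_one hd]; linarith [Nat.cast_nonneg (α := ℝ) d]
    rw [← abs_mul_abs_self]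
    nlinarith [abs_nonneg (z i)]
  calc z ⬝ᵥ z ≤ ∑ _i : Fin d, (1 : ℝ) / (d + 1) := Finset.sum_le_sum fun i _ => h1 i
    _ = d / (d + 1) := by simp [div_eq_mul_inv]
    _ ≤ 1 := by rw [div_le_one hd]; linarith

/-- In terms of the projections of `u` and `v` to `ℝⁿ⁻¹`, the kernel is dominated by a Japanese
bracket scaled by `e^t`. -/
theorem zonal_le {s t : ℝ} (hs : 0 ≤ s) (ht : 0 ≤ t) {u v : Fin (d + 1) → ℝ} (hu : u ⬝ᵥ u = 1)
    (hv : v ⬝ᵥ v = 1) :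
    zonal s t (u ⬝ᵥ v) ≤ ENNReal.ofReal (16 ^ s * Real.exp (s * t)) *
      ENNReal.ofReal ((1 + ‖Real.exp t • (Fin.init v - Fin.init u : Fin d → ℝ)‖) ^ (-(2 * s))) := by
  set r := ‖(Fin.init v - Fin.init u : Fin d → ℝ)‖ with hr
  set x := u ⬝ᵥ v with hx
  -- `2 - 2x` is the squared distance of `u` and `v`
  have hr2 : r ^ 2 ≤ 2 - 2 * x := by
    have h1 : (v - u) ⬝ᵥ (v - u) = 2 - 2 * x := by
      rw [sub_dotProduct, dotProduct_sub, dotProduct_sub, hu, hv, dotProduct_comm v u]; ring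
    rw [← h1]
    have h0 : 0 ≤ (v - u) ⬝ᵥ (v - u) := Finset.sum_nonneg fun i _ => mul_self_nonneg _
    refine (Real.le_sqrt (norm_nonneg _) h0).1 ?_
    refine (pi_norm_le_iff_of_nonneg (Real.sqrt_nonneg _)).2 fun i => ?_
    refine Real.le_sqrt_of_sq_le ?_
    rw [Real.norm_eq_abs, sq_abs, sq]
    exact Finset.single_le_sum (f := fun i => (v - u) i * (v - u) i)
      (fun i _ => mul_self_nonneg _) (Finset.mem_univ i.castSucc)
  have hx1 : -1 ≤ x := by
    have h1 : 0 ≤ (v + u) ⬝ᵥ (v + u) := Finset.sum_nonneg fun i _ => mul_self_nonneg _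
    rw [add_dotProduct, dotProduct_add, dotProduct_add, hu, hv, dotProduct_comm v u] at h1
    linarith
  have hr0 : 0 ≤ r := norm_nonneg _
  set E := Real.exp t with hE
  have hE0 : 0 < E := Real.exp_pos t
  have hE1 : 1 ≤ E := Real.one_le_exp ht
  have key : (1 + E * r) ^ 2 / (16 * E) ≤ Real.cosh t - Real.sinh t * x := by
    rw [Real.cosh_eq, Real.sinh_eq, Real.exp_neg, ← hE]
    have h3 : (E + E⁻¹) / 2 - (E - E⁻¹) / 2 * x = (8 * (E ^ 2 * (1 - x) + (1 + x))) / (16 * E) := by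
      field_simp; ring
    rw [h3]
    refine div_le_div_of_nonneg_right ?_ (by positivity)
    have h4 : E ^ 2 * r ^ 2 ≤ E ^ 2 * (2 - 2 * x) := mul_le_mul_of_nonneg_left hr2 (by positivity)
    have h5 : 0 ≤ 1 - x := by nlinarith
    have h6 : 1 * (1 - x) ≤ E ^ 2 * (1 - x) := mul_le_mul_of_nonneg_right (by nlinarith) h5
    nlinarith [sq_nonneg (1 - E * r)]
  have hpos : 0 < (1 + E * r) ^ 2 / (16 * E) := by positivity
  have hn : ‖E • (Fin.init v - Fin.init u : Fin d → ℝ)‖ = E * r := by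
    rw [norm_smul, Real.norm_eq_abs, abs_of_pos hE0]
  rw [zonal, ← ENNReal.ofReal_mul (by positivity), hn]
  refine ENNReal.ofReal_le_ofReal ?_
  refine (Real.rpow_le_rpow_of_nonpos hpos key (by linarith)).trans (le_of_eq ?_)
  rw [Real.div_rpow (by positivity) (by positivity), Real.mul_rpow (by norm_num) hE0.le,
    ← Real.rpow_natCast, ← Real.rpow_mul (by positivity), Real.rpow_neg hE0.le,
    Real.rpow_neg (by norm_num : (0 : ℝ) ≤ 16), mul_comm s t, Real.exp_mul, ← hE]
  push_cast
  rw [mul_neg]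
  field_simp

/-- The `L¹` norm of the kernel is `O(e^{(s-2ρ)t})`, where `2ρ = d`. -/
theorem exists_lintegral_zonal_le (μ : Measure (K (d + 1))) [μ.IsMulLeftInvariant]
    [IsProbabilityMeasure μ] {s : ℝ} (hs : (d : ℝ) < 2 * s) :
    ∃ γ : ℝ, 0 < γ ∧ ∀ t, 0 ≤ t →
      ∫⁻ h, zonal s t (axis h (Fin.last d)) ∂μ ≤ ENNReal.ofReal (γ * Real.exp ((s - d) * t)) := by
  have hs0 : 0 ≤ s := by linarith [Nat.cast_nonneg (α := ℝ) d]
  set B := Metric.ball (0 : Fin d → ℝ) (1 / (d + 1)) with hB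
  have hB0 : volume B ≠ 0 := (Metric.measure_ball_pos volume _ (by positivity)).ne'
  have hBt : volume B ≠ ∞ := measure_ball_lt_top.ne
  set J := ∫⁻ z : Fin d → ℝ, ENNReal.ofReal ((1 + ‖z‖) ^ (-(2 * s))) with hJ
  have hJt : J ≠ ∞ := (finite_integral_one_add_norm (by simpa using hs)).ne
  set C := 16 ^ s * J.toReal / (volume B).toReal with hC
  refine ⟨C + 1, by positivity, fun t ht => ?_⟩
  set A := ∫⁻ h, zonal s t (axis h (Fin.last d)) ∂μ with hA
  have h1 : ∀ z ∈ B, A = ∫⁻ h, zonal s t (hemisphere z ⬝ᵥ axis h) ∂μ := by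
    intro z hz
    obtain ⟨k, hk⟩ := exists_axis_eq (hemisphere_dot_self (dot_self_le_one hz))
      (by simp [hemisphere, Real.sqrt_nonneg])
    rw [← hk, lintegral_zonal_axis]
  have hm : Measurable fun p : (Fin d → ℝ) × K (d + 1) => zonal s t (hemisphere p.1 ⬝ᵥ axis p.2) :=
    (measurable_zonal s t).comp (measurable_dot.comp
      ((measurable_hemisphere.comp measurable_fst).prodMk (measurable_axis.comp measurable_snd)))
  -- the rescaled Japanese bracket
  have h2 : ∀ y : Fin d → ℝ, ∫⁻ z : Fin d → ℝ,
      ENNReal.ofReal ((1 + ‖Real.exp t • (y - z)‖) ^ (-(2 * s))) =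
        ENNReal.ofReal (Real.exp (-(d * t))) * J := by
    intro y
    have hg : Measurable fun z : Fin d → ℝ => ENNReal.ofReal ((1 + ‖z‖) ^ (-(2 * s))) := by
      fun_prop
    rw [lintegral_sub_left_eq_self
      (fun z : Fin d → ℝ => ENNReal.ofReal ((1 + ‖Real.exp t • z‖) ^ (-(2 * s)))) y,
      ← lintegral_map (f := fun z : Fin d → ℝ => ENNReal.ofReal ((1 + ‖z‖) ^ (-(2 * s)))) hg
        (measurable_const_smul (Real.exp t)),
      Measure.map_addHaar_smul _ (Real.exp_pos t).ne', lintegral_smul_measure, smul_eq_mul]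
    congr 2
    rw [Module.finrank_fin_fun, abs_of_pos (by positivity), ← Real.exp_nat_mul, Real.exp_neg]
  have h3 : A * volume B ≤ ENNReal.ofReal (16 ^ s * Real.exp (s * t)) *
      (ENNReal.ofReal (Real.exp (-(d * t))) * J) := by
    calc A * volume B = ∫⁻ z in B, ∫⁻ h, zonal s t (hemisphere z ⬝ᵥ axis h) ∂μ := by
          rw [← setLIntegral_const]
          exact setLIntegral_congr_fun measurableSet_ball h1
      _ = ∫⁻ h, ∫⁻ z in B, zonal s t (hemisphere z ⬝ᵥ axis h) ∂volume ∂μ :=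
          lintegral_lintegral_swap hm.aemeasurable
      _ ≤ ∫⁻ _h, ENNReal.ofReal (16 ^ s * Real.exp (s * t)) *
          (ENNReal.ofReal (Real.exp (-(d * t))) * J) ∂μ := by
          refine lintegral_mono fun h => ?_
          rw [← h2 (Fin.init (axis h)), ← lintegral_const_mul' _ _ ENNReal.ofReal_ne_top]
          refine (setLIntegral_mono' measurableSet_ball fun z hz => ?_).trans
            (setLIntegral_le_lintegral B _)
          have h4 := zonal_le hs0 ht (hemisphere_dot_self (dot_self_le_one hz)) (axis_dot_self h)
          rwa [show (Fin.init (hemisphere z) : Fin d → ℝ) = z from Fin.init_snoc _ _] at h4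
      _ = _ := by simp
  rw [← ENNReal.le_div_iff_mul_le (Or.inl hB0) (Or.inl hBt)] at h3
  refine h3.trans ?_
  rw [← ENNReal.ofReal_toReal hJt, ← ENNReal.ofReal_toReal hBt,
    ← ENNReal.ofReal_mul (by positivity), ← ENNReal.ofReal_mul (by positivity),
    ← ENNReal.ofReal_div_of_pos (ENNReal.toReal_pos hB0 hBt)]
  refine ENNReal.ofReal_le_ofReal ?_
  have h5 : Real.exp ((s - d) * t) = Real.exp (s * t) * Real.exp (-(d * t)) := by
    rw [← Real.exp_add]; congr 1; ring
  rw [h5]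
  have h6 : 16 ^ s * Real.exp (s * t) * (Real.exp (-(d * t)) * J.toReal) / (volume B).toReal =
      C * (Real.exp (s * t) * Real.exp (-(d * t))) := by
    rw [hC]; ring
  rw [h6]
  gcongr
  linarith

end Kernel

/-! ### Schur's test -/

section Schur

variable {X : Type*} [MeasurableSpace X]

/-- Schur's test for a symmetric kernel. -/
theorem lintegral_rpow_schur (μ : Measure X) [SFinite μ] {w : X → X → ℝ≥0∞}
    (hw : Measurable (Function.uncurry w)) (hsymm : ∀ x y, w x y = w y x) {A : ℝ≥0∞}
    (hA : ∀ x, ∫⁻ y, w x y ∂μ ≤ A) {p : ℝ} (hp : 1 < p) {F : X → ℝ≥0∞} (hF : AEMeasurable F μ) :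
    ∫⁻ x, (∫⁻ y, w x y * F y ∂μ) ^ p ∂μ ≤ A ^ p * ∫⁻ y, F y ^ p ∂μ := by
  have hp0 : 0 < p := by linarith
  have hpq := Real.HolderConjugate.conjExponent hp
  set q := p.conjExponent with hq
  have hq0 : 0 < q := hpq.symm.pos
  have hwx : ∀ x, Measurable (w x) := fun x => hw.comp measurable_prodMk_left
  have h1 : ∀ x, (∫⁻ y, w x y * F y ∂μ) ^ p ≤ A ^ (p - 1) * ∫⁻ y, w x y * F y ^ p ∂μ := by
    intro x
    have h2 : ∫⁻ y, w x y * F y ∂μ ≤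
        (∫⁻ y, w x y ∂μ) ^ (1 / q) * (∫⁻ y, w x y * F y ^ p ∂μ) ^ (1 / p) := by
      have h3 := ENNReal.lintegral_mul_le_Lp_mul_Lq μ hpq.symm
        (f := fun y => w x y ^ (1 / q)) (g := fun y => w x y ^ (1 / p) * F y)
        ((hwx x).pow_const _).aemeasurable (((hwx x).pow_const _).aemeasurable.mul hF)
      refine le_trans (le_of_eq ?_) (h3.trans (le_of_eq ?_))
      · refine lintegral_congr fun y => ?_
        rw [Pi.mul_apply, ← mul_assoc, ← ENNReal.rpow_add_of_nonneg _ _ (by positivity)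
          (by positivity), one_div, one_div, hpq.symm.inv_add_inv_eq_one, ENNReal.rpow_one]
      · congr 2
        · refine lintegral_congr fun y => ?_
          rw [← ENNReal.rpow_mul, one_div, inv_mul_cancel₀ hq0.ne', ENNReal.rpow_one]
        · refine lintegral_congr fun y => ?_
          rw [ENNReal.mul_rpow_of_nonneg _ _ hp0.le, ← ENNReal.rpow_mul, one_div,
            inv_mul_cancel₀ hp0.ne', ENNReal.rpow_one]
    calc (∫⁻ y, w x y * F y ∂μ) ^ p
        ≤ ((∫⁻ y, w x y ∂μ) ^ (1 / q) * (∫⁻ y, w x y * F y ^ p ∂μ) ^ (1 / p)) ^ p := by gcongr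
      _ = (∫⁻ y, w x y ∂μ) ^ (p - 1) * ∫⁻ y, w x y * F y ^ p ∂μ := by
          rw [ENNReal.mul_rpow_of_nonneg _ _ hp0.le, ← ENNReal.rpow_mul, ← ENNReal.rpow_mul,
            one_div_mul_cancel hp0.ne', ENNReal.rpow_one]
          congr 2
          rw [hq, Real.conjExponent]
          field_simp
      _ ≤ _ := by
          gcongr
          exact hA x
  have hFm : AEMeasurable (Function.uncurry fun x y => w x y * F y ^ p) (μ.prod μ) :=
    hw.aemeasurable.mul (hF.comp_snd.pow_const p)
  calc ∫⁻ x, (∫⁻ y, w x y * F y ∂μ) ^ p ∂μ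
      ≤ ∫⁻ x, A ^ (p - 1) * ∫⁻ y, w x y * F y ^ p ∂μ ∂μ := lintegral_mono h1
    _ = A ^ (p - 1) * ∫⁻ x, ∫⁻ y, w x y * F y ^ p ∂μ ∂μ :=
        lintegral_const_mul'' _ hFm.lintegral_prod_right'
    _ = A ^ (p - 1) * ∫⁻ y, ∫⁻ x, w x y * F y ^ p ∂μ ∂μ := by
        rw [lintegral_lintegral_swap hFm]
    _ ≤ A ^ (p - 1) * ∫⁻ y, A * F y ^ p ∂μ := by
        gcongr with y
        have hy : Measurable fun x => w x y := by simpa only [hsymm _ y] using hwx y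
        rw [lintegral_mul_const _ hy]
        gcongr
        simpa only [hsymm _ y] using hA y
    _ = _ := by
        rw [lintegral_const_mul'' _ (hF.pow_const p), ← mul_assoc]
        congr 1
        nth_rewrite 2 [← ENNReal.rpow_one A]
        rw [← ENNReal.rpow_add_of_nonneg _ _ (by linarith) zero_le_one, sub_add_cancel]

end Schur

/-! ### Poisson integrals -/

section Integral

variable {d : ℕ} {s : ℤˣ} {V : Type*} [NormedAddCommGroup V] [InnerProductSpace ℂ V]

theorem H_eq_log (g : G (d + 1)) :
    H g = 2 * Real.log ‖(lorentzOp (d + 1) (g : ClL d) (nulSpinor d (vacuum (d + 1)))).1‖ := by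
  rw [lorentzOp_apply, norm_lorentzRep_nulSpinor, norm_vacuum, mul_one, Real.log_exp]
  ring

/-- `H(g⁻¹k)` is bounded below, uniformly in `k ∈ K`. -/
theorem exp_neg_H_le (g : G (d + 1)) (k : K (d + 1)) :
    Real.exp (-(H (g⁻¹ * inclK (d + 1) k) / 2)) ≤ ‖lorentzOp (d + 1) (g : ClL d)‖ := by
  set φ := vacuum (d + 1)
  have hφ : ‖φ‖ = 1 := norm_vacuum
  set h := g⁻¹ * inclK (d + 1) k with hh
  have h1 : lorentzOp (d + 1) (g : ClL d) (lorentzRep (d + 1) (h : ClL d) (nulSpinor d φ)) =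
      (spinRep (d + 1) k φ, spinRep (d + 1) k (cliffordMul (d + 1) (lastVec d) φ)) := by
    rw [lorentzOp_apply, ← Module.End.mul_apply, ← map_mul, ← Submonoid.coe_mul, hh,
      mul_inv_cancel_left, lorentzRep_inclK, nulSpinor_apply]
  have h2 : ‖lorentzRep (d + 1) (h : ClL d) (nulSpinor d φ)‖ = Real.exp (H h / 2) := by
    have h3 : ‖cliffordMul (d + 1) (lastVec d) φ‖ = 1 := by
      have := norm_cliffordMul_sq (lastVec d) φ
      have hl : lastVec d ⬝ᵥ lastVec d = 1 := by simp
      rw [hφ, hl, one_pow, mul_one] at this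
      exact (pow_eq_one_iff_of_nonneg (norm_nonneg _) two_ne_zero).1 this
    rw [lorentzRep_nulSpinor, norm_smul, Prod.norm_mk, norm_spinRep, norm_spinRep, h3, hφ,
      Real.norm_eq_abs, Real.abs_exp, max_self, mul_one]
  have h4 : 1 ≤ ‖lorentzOp (d + 1) (g : ClL d)‖ * Real.exp (H h / 2) := by
    rw [← h2]
    refine le_trans ?_ (ContinuousLinearMap.le_opNorm _ _)
    rw [h1]
    refine le_trans (le_of_eq ?_) (norm_fst_le _)
    rw [norm_spinRep, hφ]
  rw [Real.exp_neg]
  exact (inv_le_iff_one_le_mul₀ (Real.exp_pos _)).2 h4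

theorem norm_integrand {n : ℕ} (ι : V →ₗᵢ[ℂ] Vtau n s) (lam : ℂ) (x : ℝ) (k : K n) (v : V) :
    ‖Complex.exp (-(Complex.I * lam + rho n) * x) • tau n s k (ι v)‖ =
      Real.exp (-((Complex.I * lam).re + rho n) * x) * ‖v‖ := by
  have h : ‖tau n s k (ι v)‖ = ‖v‖ := by
    rw [← ι.norm_map v]
    exact norm_spinRep k _
  rw [norm_smul, h, Complex.norm_exp]
  congr 2
  rw [Complex.re_mul_ofReal, Complex.neg_re, Complex.add_re, Complex.ofReal_re]

/-- Measurability of the Poisson integrand, along a family of elements of `G` that acts measurably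
on spinors. -/
theorem aestronglyMeasurable_integrand {X : Type*} [MeasurableSpace X] {ν : Measure X}
    {Γ : X → G (d + 1)} (hΓ : StronglyMeasurable fun x => lorentzOp (d + 1) (Γ x : ClL d))
    {F : X → V} (hF : AEStronglyMeasurable F ν) (ι : V →ₗᵢ[ℂ] Vtau (d + 1) s) (lam : ℂ) :
    AEStronglyMeasurable (fun x => Complex.exp (-(Complex.I * lam + rho (d + 1)) * H (Γ x)) •
      tau (d + 1) s (kappa (Γ x)) (ι (F x))) ν := by
  have hH : Measurable fun x => H (Γ x) := by
    simp only [H_eq_log]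
    exact (Real.measurable_log.comp
      ((ContinuousLinearMap.apply ℂ _ (nulSpinor d (vacuum (d + 1)))).continuous
        |>.comp_stronglyMeasurable hΓ).fst.norm.measurable).const_mul 2
  rw [← Topology.IsEmbedding.subtypeVal.aestronglyMeasurable_comp_iff]
  have h1 : ∀ x, ((Complex.exp (-(Complex.I * lam + rho (d + 1)) * H (Γ x)) •
      tau (d + 1) s (kappa (Γ x)) (ι (F x)) : Vtau (d + 1) s) : Spinor (d + 1)) =
      Complex.exp (-(Complex.I * lam + rho (d + 1)) * H (Γ x)) • Real.exp (-(H (Γ x) / 2)) •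
        (lorentzOp (d + 1) (Γ x : ClL d) (nulSpinor d (ι (F x)))).1 := by
    intro x
    rw [lorentzOp_apply, lorentzRep_nulSpinor, Prod.smul_fst, smul_smul (Real.exp _),
      ← Real.exp_add, neg_add_cancel, Real.exp_zero, one_smul]
    rfl
  simp only [h1]
  have h2 : AEStronglyMeasurable (fun x => nulSpinor d (ι (F x))) ν :=
    ((LinearMap.continuous_of_finiteDimensional (nulSpinor d)).comp
      (continuous_subtype_val.comp ι.continuous)).comp_aestronglyMeasurable hF
  have h3 : AEStronglyMeasurable
      (fun x => lorentzOp (d + 1) (Γ x : ClL d) (nulSpinor d (ι (F x)))) ν :=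
    isBoundedBilinearMap_apply.continuous.comp_aestronglyMeasurable
      (hΓ.aestronglyMeasurable.prodMk h2)
  have h4 : Measurable fun x => Complex.exp (-(Complex.I * lam + rho (d + 1)) * H (Γ x)) := by
    fun_prop
  have h5 : Measurable fun x => Real.exp (-(H (Γ x) / 2)) := by fun_prop
  exact h4.aestronglyMeasurable.smul (h5.aestronglyMeasurable.smul h3.fst)

theorem slashKappa_nonneg (n : ℕ) : 0 ≤ slashKappa n s V := Real.sqrt_nonneg _

theorem rho_succ : rho (d + 1) = d / 2 := by rw [rho]; push_cast; ring

theorem integrable_poissonIntegrand (μ : Measure (K (d + 1))) {lam : ℂ}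
    (hlam : 0 < (Complex.I * lam).re) (ι : V →ₗᵢ[ℂ] Vtau (d + 1) s) {f : K (d + 1) → V}
    (hf : Integrable f μ) (g : G (d + 1)) : Integrable (poissonIntegrand ι lam f g) μ := by
  set r := (Complex.I * lam).re + rho (d + 1) with hr
  have hr0 : 0 ≤ r := by rw [hr, rho_succ]; positivity
  refine (hf.norm.const_mul (‖lorentzOp (d + 1) (g : ClL d)‖ ^ (2 * r))).mono'
    (aestronglyMeasurable_integrand ?_ hf.aestronglyMeasurable ι lam)
    (Filter.Eventually.of_forall fun k => ?_)
  · simp only [Submonoid.coe_mul, lorentzOp_mul]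
    exact (continuous_lorentzOp_inclK.stronglyMeasurable).const_mul _
  · rw [poissonIntegrand, norm_integrand]
    gcongr
    have h1 := Real.rpow_le_rpow (Real.exp_pos _).le (exp_neg_H_le g k)
      (by positivity : 0 ≤ 2 * r)
    rw [← Real.exp_mul] at h1
    refine le_trans (le_of_eq ?_) h1
    congr 1
    ring

theorem normLp_eq {n : ℕ} {μ : Measure (K n)} {E : Type*} [NormedAddCommGroup E]
    [InnerProductSpace ℂ E] {p : ℝ} (hp : 0 < p) {f : K n → E}
    (hf : MemLp f (ENNReal.ofReal p) μ) :
    normLp μ p f = (eLpNorm f (ENNReal.ofReal p) μ).toReal := by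
  rw [hf.eLpNorm_eq_integral_rpow_norm (by simpa using hp) ENNReal.ofReal_ne_top,
    ENNReal.toReal_ofReal hp.le, ENNReal.toReal_ofReal (by positivity), normLp, one_div]

theorem aestronglyMeasurable_poisson (μ : Measure (K (d + 1))) [SFinite μ] (lam : ℂ)
    (ι : V →ₗᵢ[ℂ] Vtau (d + 1) s) {f : K (d + 1) → V} (hf : AEStronglyMeasurable f μ) (t : ℝ) :
    AEStronglyMeasurable (fun k => poisson μ ι lam f (inclK (d + 1) k * a t)) μ := by
  suffices h : AEStronglyMeasurable (fun k => ∫ h,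
      poissonIntegrand ι lam f (inclK (d + 1) k * a t) h ∂μ) μ from
    h.const_smul (slashKappa (d + 1) s V)
  refine AEStronglyMeasurable.integral_prod_right' (f := fun q : K (d + 1) × K (d + 1) =>
    poissonIntegrand ι lam f (inclK (d + 1) q.1 * a t) q.2) ?_
  refine aestronglyMeasurable_integrand ?_ hf.comp_snd ι lam
  simp only [mul_inv_rev, Submonoid.coe_mul, lorentzOp_mul]
  exact ((continuous_lorentzOp_inclK_inv.stronglyMeasurable.comp_measurable
    measurable_fst).const_mul _).mul
      (continuous_lorentzOp_inclK.stronglyMeasurable.comp_measurable measurable_snd)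

/-- The Poisson transform is dominated by the integral operator with the zonal kernel. -/
theorem enorm_poisson_le (μ : Measure (K (d + 1))) (lam : ℂ) (ι : V →ₗᵢ[ℂ] Vtau (d + 1) s)
    (f : K (d + 1) → V) (t : ℝ) (k : K (d + 1)) :
    ‖poisson μ ι lam f (inclK (d + 1) k * a t)‖ₑ ≤ ENNReal.ofReal (slashKappa (d + 1) s V) *
      ∫⁻ h, zonal ((Complex.I * lam).re + rho (d + 1)) t (axis k ⬝ᵥ axis h) * ‖f h‖ₑ ∂μ := by
  rw [poisson, enorm_smul, Real.enorm_of_nonneg (slashKappa_nonneg _)]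
  gcongr
  refine (enorm_integral_le_lintegral_enorm _).trans (le_of_eq (lintegral_congr fun h => ?_))
  rw [zonal_axis, ← ofReal_norm, ← ofReal_norm, ← ENNReal.ofReal_mul (Real.exp_pos _).le,
    poissonIntegrand, norm_integrand]

/-- The bound on `L^p`, from a bound on the mass of the zonal kernel. -/
theorem eLpNorm_poisson_le (μ : Measure (K (d + 1))) [μ.IsMulLeftInvariant] [SFinite μ] (lam : ℂ)
    (ι : V →ₗᵢ[ℂ] Vtau (d + 1) s) {f : K (d + 1) → V} (hf : AEStronglyMeasurable f μ) {p : ℝ}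
    (hp : 1 < p) (t : ℝ) {A : ℝ≥0∞}
    (hA : ∫⁻ h, zonal ((Complex.I * lam).re + rho (d + 1)) t (axis h (Fin.last d)) ∂μ ≤ A) :
    eLpNorm (fun k => poisson μ ι lam f (inclK (d + 1) k * a t)) (ENNReal.ofReal p) μ ≤
      ENNReal.ofReal (slashKappa (d + 1) s V) * A * eLpNorm f (ENNReal.ofReal p) μ := by
  have hp0 : 0 < p := by linarith
  have hpne : ENNReal.ofReal p ≠ 0 := by simpa using hp0
  set κ := ENNReal.ofReal (slashKappa (d + 1) s V)
  set w := fun k h : K (d + 1) =>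
    zonal ((Complex.I * lam).re + rho (d + 1)) t (axis k ⬝ᵥ axis h) with hw
  have hschur := lintegral_rpow_schur μ (w := w) (measurable_zonal_axis _ t)
    (fun k h => by rw [hw]; simp only [dotProduct_comm]) (A := A)
    (fun k => (lintegral_zonal_axis μ _ t k).trans_le hA) hp hf.enorm
  rw [eLpNorm_eq_lintegral_rpow_enorm_toReal hpne ENNReal.ofReal_ne_top,
    eLpNorm_eq_lintegral_rpow_enorm_toReal hpne ENNReal.ofReal_ne_top, ENNReal.toReal_ofReal hp0.le]
  have h1 : ∫⁻ k, ‖poisson μ ι lam f (inclK (d + 1) k * a t)‖ₑ ^ p ∂μ ≤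
      (κ * A) ^ p * ∫⁻ h, ‖f h‖ₑ ^ p ∂μ := by
    calc ∫⁻ k, ‖poisson μ ι lam f (inclK (d + 1) k * a t)‖ₑ ^ p ∂μ
        ≤ ∫⁻ k, κ ^ p * (∫⁻ h, w k h * ‖f h‖ₑ ∂μ) ^ p ∂μ := by
          refine lintegral_mono fun k => ?_
          rw [← ENNReal.mul_rpow_of_nonneg _ _ hp0.le]
          exact ENNReal.rpow_le_rpow (enorm_poisson_le μ lam ι f t k) hp0.le
      _ = κ ^ p * ∫⁻ k, (∫⁻ h, w k h * ‖f h‖ₑ ∂μ) ^ p ∂μ :=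
          lintegral_const_mul' _ _ (ENNReal.rpow_ne_top_of_nonneg hp0.le ENNReal.ofReal_ne_top)
      _ ≤ κ ^ p * (A ^ p * ∫⁻ h, ‖f h‖ₑ ^ p ∂μ) := by gcongr
      _ = _ := by rw [ENNReal.mul_rpow_of_nonneg _ _ hp0.le, mul_assoc]
  calc (∫⁻ k, ‖poisson μ ι lam f (inclK (d + 1) k * a t)‖ₑ ^ p ∂μ) ^ (1 / p)
      ≤ ((κ * A) ^ p * ∫⁻ h, ‖f h‖ₑ ^ p ∂μ) ^ (1 / p) := by gcongr
    _ = κ * A * (∫⁻ h, ‖f h‖ₑ ^ p ∂μ) ^ (1 / p) := by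
        rw [ENNReal.mul_rpow_of_nonneg _ _ (by positivity), ← ENNReal.rpow_mul,
          mul_one_div_cancel hp0.ne', ENNReal.rpow_one]

end Integral

end SpinPoisson

end

open SpinPoisson in
theorem mainTheorem6 (n : ℕ) [NeZero n] (hn : 2 ≤ n)
    (μ : Measure (K n)) [μ.IsHaarMeasure] [IsProbabilityMeasure μ]
    (lam : ℂ) (hlam : 0 < (Complex.I * lam).re) :
    ∃ γ : ℝ, 0 < γ ∧
      ∀ (s : ℤˣ) (V : Type*) [NormedAddCommGroup V] [InnerProductSpace ℂ V]
        (σ : Representation ℂ (M n) V) (ι : V →ₗᵢ[ℂ] Vtau n s), IsConstituent σ ι →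
      ∀ p : ℝ, 1 < p → ∀ f : K n → V, IsLpSection μ p σ f →
        (∀ g : G n, Integrable (poissonIntegrand ι lam f g) μ) ∧
        ∀ t : ℝ, 0 ≤ t →
          MemLp (fun k => poisson μ ι lam f (inclK n k * a t)) (ENNReal.ofReal p) μ ∧
          normLp μ p (fun k => poisson μ ι lam f (inclK n k * a t)) ≤
            slashKappa n s V * γ * Real.exp (((Complex.I * lam).re - rho n) * t) *
              normLp μ p f := by
  obtain ⟨d, rfl⟩ : ∃ d, n = d + 1 := Nat.exists_eq_succ_of_ne_zero (NeZero.ne n)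
  obtain ⟨γ, hγ, hbound⟩ := exists_lintegral_zonal_le μ
    (s := (Complex.I * lam).re + rho (d + 1)) (by rw [rho_succ]; linarith)
  refine ⟨γ, hγ, ?_⟩
  rintro s V _ _ σ ι - p hp f ⟨hf, -⟩
  have hp0 : 0 < p := by linarith
  refine ⟨integrable_poissonIntegrand μ hlam ι
    (hf.integrable (by rw [← ENNReal.ofReal_one]; exact ENNReal.ofReal_le_ofReal hp.le)),
    fun t ht => ?_⟩
  have hexp : (Complex.I * lam).re + rho (d + 1) - d = (Complex.I * lam).re - rho (d + 1) := by
    rw [rho_succ]; ring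
  have hA := hbound t ht
  rw [hexp] at hA
  have hle := eLpNorm_poisson_le μ lam ι hf.aestronglyMeasurable hp t hA
  have hfin := ENNReal.mul_lt_top (ENNReal.mul_lt_top (ENNReal.ofReal_lt_top
    (r := slashKappa (d + 1) s V)) (ENNReal.ofReal_lt_top
    (r := γ * Real.exp (((Complex.I * lam).re - rho (d + 1)) * t)))) hf.eLpNorm_lt_top
  have hmem : MemLp (fun k => poisson μ ι lam f (inclK (d + 1) k * a t)) (ENNReal.ofReal p) μ :=
    ⟨aestronglyMeasurable_poisson μ lam ι hf.aestronglyMeasurable t, hle.trans_lt hfin⟩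
  refine ⟨hmem, ?_⟩
  rw [normLp_eq hp0 hmem, normLp_eq hp0 hf]
  refine (ENNReal.toReal_mono hfin.ne hle).trans (le_of_eq ?_)
  rw [ENNReal.toReal_mul, ENNReal.toReal_mul, ENNReal.toReal_ofReal (slashKappa_nonneg _),
    ENNReal.toReal_ofReal (by positivity)]
  ring
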